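/- **Jump law of the co-state at a time-invariant switching interface.** *Problem.* Let $t_0<t_f$, $x_0\in\mathbb R^n$, let $g,\phi:\mathbb R^n\to\mathbb R$ be $C^1$, and for $i=1,2$ let $f_i:\mathbb R^n\times\mathbb R^m\times\mathbb R\to\mathbb R^n$ and $L_i:\mathbb R^n\times\mathbb R^m\times\mathbb R\to\mathbb R$ be continuous in $(x,u,t)$ and differentiable in $(x,u)$ with derivative continuous in $(x,u,t)$. An admissible process consists of a switching time $\tau\in(t_0,t_f)$, controls $u_1,u_2$ continuous on $[t_0,\tau]$ and $[\tau,t_f]$ respectively, and a continuous state $x$ on $[t_0,t_f]$ (equal to $x_1$ on $[t_0,\tau]$ and to $x_2$ on $[\tau,t_f]$) with $\dot x_1=f_1(x_1,u_1,t)$ and $\dot x_2=f_2(x_2,u_2,t)$ on these intervals, $x(t_0)=x_0$, $g(x)<0$ on $[t_0,\tau)$, $g(x(\tau))=0$, $g(x)>0$ on $(\tau,t_f]$, and, if a final state $x_f$ is prescribed, $x(t_f)=x_f$ (both the prescribed and the free final state are allowed). It is optimal if it minimizes $$J=\phi(x(t_f))+\int_{t_0}^{\tau}L_1(x_1,u_1,t)\,dt+\int_{\tau}^{t_f}L_2(x_2,u_2,t)\,dt$$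 among all admissible processes (hence also over $\tau$). *Co-state.* Put $H_i(x,\lambda,u,t)=L_i(x,u,t)+\lambda^\top f_i(x,u,t)$. For $a\in\mathbb R$, continuous $\lambda_1,\lambda_2$, $\nu\in\mathbb R$ and $\kappa\in\mathbb R^n$ consider the augmented cost of arbitrary $(T,y_1,y_2,v_1,v_2)$, $$a\,\phi(y_2(t_f))+\nu\, g(y_1(T))+\kappa^\top\big(y_2(T)-y_1(T)\big)+\int_{t_0}^{T}\!\big(aL_1(y_1,v_1,t)+\lambda_1^\top(f_1(y_1,v_1,t)-\dot y_1)\big)dt+\int_{T}^{t_f}\!\big(aL_2(y_2,v_2,t)+\lambda_2^\top(f_2(y_2,v_2,t)-\dot y_2)\big)dt .$$ Call $(a,\lambda_1,\lambda_2,\nu,\kappa)$ *stationary* at a process if the first variation of the augmented cost at $(\tau,x_1,x_2,u_1,u_2)$ vanishes for all $\delta\tau\in\mathbb R$, all continuous $\delta u_1,\delta u_2$ and all $C^1$ functions $\delta x_1,\delta x_2$ with $\delta x_1(t_0)=0$ (and $\delta x_2(t_f)=0$ if the final state is prescribed). A *co-state* is a pair of continuous $\lambda_1$ on $[t_0,\tau]$,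 $\lambda_2$ on $[\tau,t_f]$ such that $\dot\lambda_i=-(\partial H_i/\partial x)^\top$ on the respective open phase and $(1,\lambda_1,\lambda_2,\nu,\kappa)$ is stationary for some $\nu,\kappa$. The process is *normal* if every stationary $(0,\lambda_1,\lambda_2,\nu,\kappa)$ has $\lambda_1=0$ on $[t_0,\tau]$ and $\lambda_2=0$ on $[\tau,t_f]$. *Statement.* Let $(\tau,x,u)$ be optimal. Write $f_i,L_i,\lambda_i$ for the values along it at $\tau$ (those with index $1$ just before, with index $2$ just after the switch), $m=\frac{\partial g}{\partial x}(x(\tau))$ (a column vector), $\Delta f=f_2-f_1$, $\Delta L=L_2-L_1$, $\Delta\lambda=\lambda_2-\lambda_1$, $\langle f\rangle=\tfrac12(f_1+f_2)$, $\langle\lambda\rangle=\tfrac12(\lambda_1+\lambda_2)$. 1. If $m^\top\langle f\rangle\neq0$, then every co-state satisfies $$\Delta\lambda=-\frac{\big(\Delta L+\langle\lambda\rangle^\top\Delta f\big)\,m}{m^\top\langle f\rangle}.$$ 2. If the crossing is transversal, $m^\top f_1\ne0$ and $m^\top f_2\neq0$, and if the final state is free or the process is normal, then $m^\top\langle f\rangle\ne0$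 and a co-state exists. -/

import Mathlib

open scoped Gradient InnerProductSpace

noncomputable section

/-- The data of a two-mode optimal control problem with state space `ℝⁿ`, control space `ℝᵐ` and
time-invariant switching interface `g x = 0`.  Mode 1 (dynamics `f₁`, running cost `L₁`) is active
where `g ≤ 0`, mode 2 where `0 ≤ g`.  The times `t₀`, `tf` and the initial state `x₀` are fixed,
`φ` is the terminal cost.  `target = some xf` prescribes the final state `x tf = xf`;
`target = none` leaves the final state free. -/
structure SwitchedProblem (n m : ℕ) where
  f₁ : EuclideanSpace ℝ (Fin n) → EuclideanSpace ℝ (Fin m) → ℝ → EuclideanSpace ℝ (Fin n)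
  f₂ : EuclideanSpace ℝ (Fin n) → EuclideanSpace ℝ (Fin m) → ℝ → EuclideanSpace ℝ (Fin n)
  L₁ : EuclideanSpace ℝ (Fin n) → EuclideanSpace ℝ (Fin m) → ℝ → ℝ
  L₂ : EuclideanSpace ℝ (Fin n) → EuclideanSpace ℝ (Fin m) → ℝ → ℝ
  g : EuclideanSpace ℝ (Fin n) → ℝ
  φ : EuclideanSpace ℝ (Fin n) → ℝ
  t₀ : ℝ
  tf : ℝ
  x₀ : EuclideanSpace ℝ (Fin n)
  target : Option (EuclideanSpace ℝ (Fin n))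

/-- `F (x, u, t)` is jointly continuous, and continuously differentiable in `(x, u)`: its
derivative with respect to `(x, u)` exists everywhere and is jointly continuous in `(x, u, t)`. -/
def IsC1InStateControl {n m : ℕ} {V : Type*} [NormedAddCommGroup V] [NormedSpace ℝ V]
    (F : EuclideanSpace ℝ (Fin n) → EuclideanSpace ℝ (Fin m) → ℝ → V) : Prop :=
  Continuous (fun q : (EuclideanSpace ℝ (Fin n) × EuclideanSpace ℝ (Fin m)) × ℝ =>
      F q.1.1 q.1.2 q.2) ∧
  (∀ t : ℝ, Differentiable ℝ
      (fun z : EuclideanSpace ℝ (Fin n) × EuclideanSpace ℝ (Fin m) => F z.1 z.2 t)) ∧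
  Continuous (fun q : (EuclideanSpace ℝ (Fin n) × EuclideanSpace ℝ (Fin m)) × ℝ =>
      fderiv ℝ (fun z : EuclideanSpace ℝ (Fin n) × EuclideanSpace ℝ (Fin m) =>
        F z.1 z.2 q.2) q.1)

/-- A candidate solution, described phase by phase: a switching time `τ`, the state `x₁` and
control `u₁` of the phase `[t₀, τ]`, and the state `x₂` and control `u₂` of the phase `[τ, tf]`.
The values of the functions outside their phase are irrelevant. -/
structure SwitchedProcess (n m : ℕ) where
  τ : ℝ
  x₁ : ℝ → EuclideanSpace ℝ (Fin n)
  x₂ : ℝ → EuclideanSpace ℝ (Fin n)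
  u₁ : ℝ → EuclideanSpace ℝ (Fin m)
  u₂ : ℝ → EuclideanSpace ℝ (Fin m)

namespace SwitchedProblem

variable {n m : ℕ}

/-- Regularity of the data. -/
structure Regular (P : SwitchedProblem n m) : Prop where
  f₁ : IsC1InStateControl P.f₁
  f₂ : IsC1InStateControl P.f₂
  L₁ : IsC1InStateControl P.L₁
  L₂ : IsC1InStateControl P.L₂
  g : ContDiff ℝ 1 P.g
  φ : ContDiff ℝ 1 P.φ

/-- Admissible processes: controls continuous on each closed phase, state continuous on
`[t₀, tf]` and solving the dynamics of the active mode, exactly one crossing of the interface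
(at time `τ`), and the boundary conditions.  A control that is continuous on a closed phase, and
a state that is `C¹` on it, extend to all of `ℝ` with the same regularity, so it is no restriction
to require continuous controls and `C¹` states on `ℝ`; the two-sided derivatives at
the ends of a phase are then the one-sided ones. -/
structure Admissible (P : SwitchedProblem n m) (p : SwitchedProcess n m) : Prop where
  t₀_lt : P.t₀ < p.τ
  lt_tf : p.τ < P.tf
  u₁_cont : Continuous p.u₁
  u₂_cont : Continuous p.u₂
  x₁_C1 : ContDiff ℝ 1 p.x₁
  x₂_C1 : ContDiff ℝ 1 p.x₂
  dyn₁ : ∀ t ∈ Set.Icc P.t₀ p.τ, HasDerivAt p.x₁ (P.f₁ (p.x₁ t) (p.u₁ t) t) t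
  dyn₂ : ∀ t ∈ Set.Icc p.τ P.tf, HasDerivAt p.x₂ (P.f₂ (p.x₂ t) (p.u₂ t) t) t
  init : p.x₁ P.t₀ = P.x₀
  final : ∀ xf ∈ P.target, p.x₂ P.tf = xf
  junction : p.x₁ p.τ = p.x₂ p.τ
  before : ∀ t ∈ Set.Ico P.t₀ p.τ, P.g (p.x₁ t) < 0
  crossing : P.g (p.x₁ p.τ) = 0
  after : ∀ t ∈ Set.Ioc p.τ P.tf, 0 < P.g (p.x₂ t)

/-- The performance index `J = φ(x(tf)) + ∫ L dt`. -/
def cost (P : SwitchedProblem n m) (p : SwitchedProcess n m) : ℝ :=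
  P.φ (p.x₂ P.tf) + (∫ t in P.t₀..p.τ, P.L₁ (p.x₁ t) (p.u₁ t) t) +
    ∫ t in p.τ..P.tf, P.L₂ (p.x₂ t) (p.u₂ t) t

/-- `p` minimizes the performance index among all admissible processes (in particular over all
switching times). -/
def IsOptimal (P : SwitchedProblem n m) (p : SwitchedProcess n m) : Prop :=
  P.Admissible p ∧ ∀ q : SwitchedProcess n m, P.Admissible q → P.cost p ≤ P.cost q

/-- Hamiltonian of mode 1: `H₁(x, λ, u, t) = L₁(x, u, t) + λᵀ f₁(x, u, t)`. -/
def H₁ (P : SwitchedProblem n m) (x l : EuclideanSpace ℝ (Fin n))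
    (u : EuclideanSpace ℝ (Fin m)) (t : ℝ) : ℝ :=
  P.L₁ x u t + ⟪l, P.f₁ x u t⟫_ℝ

/-- Hamiltonian of mode 2. -/
def H₂ (P : SwitchedProblem n m) (x l : EuclideanSpace ℝ (Fin n))
    (u : EuclideanSpace ℝ (Fin m)) (t : ℝ) : ℝ :=
  P.L₂ x u t + ⟪l, P.f₂ x u t⟫_ℝ

/-- The augmented cost of an arbitrary quintuple `q = (T, y₁, y₂, v₁, v₂)`, which need not satisfy
the constraints: the cost (with weight `a`), plus multiplier terms for the interface constraint
`g(y₁(T)) = 0` (multiplier `ν`), for the continuity of the state `y₁(T) = y₂(T)` (multiplier `κ`),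
and for the dynamics `ẏᵢ = fᵢ(yᵢ, vᵢ, t)` (multipliers `lam₁`, `lam₂`):
`a φ(y₂(tf)) + ν g(y₁(T)) + κᵀ(y₂(T) - y₁(T))`
`+ ∫_{t₀}^{T} (a L₁ + lam₁ᵀ (f₁ - ẏ₁)) dt + ∫_{T}^{tf} (a L₂ + lam₂ᵀ (f₂ - ẏ₂)) dt`. -/
def augmentedCost (P : SwitchedProblem n m) (a : ℝ) (lam₁ lam₂ : ℝ → EuclideanSpace ℝ (Fin n))
    (ν : ℝ) (κ : EuclideanSpace ℝ (Fin n)) (q : SwitchedProcess n m) : ℝ :=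
  a * P.φ (q.x₂ P.tf) + ν * P.g (q.x₁ q.τ) + ⟪κ, q.x₂ q.τ - q.x₁ q.τ⟫_ℝ +
    (∫ t in P.t₀..q.τ, (a * P.L₁ (q.x₁ t) (q.u₁ t) t +
      ⟪lam₁ t, P.f₁ (q.x₁ t) (q.u₁ t) t - deriv q.x₁ t⟫_ℝ)) +
    ∫ t in q.τ..P.tf, (a * P.L₂ (q.x₂ t) (q.u₂ t) t +
      ⟪lam₂ t, P.f₂ (q.x₂ t) (q.u₂ t) t - deriv q.x₂ t⟫_ℝ)

/-- The variation `p + ε δ` of the process `p` in the direction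
`δ = (δτ, δx₁, δx₂, δu₁, δu₂)`. -/
def vary (p δ : SwitchedProcess n m) (ε : ℝ) : SwitchedProcess n m where
  τ := p.τ + ε * δ.τ
  x₁ := fun t => p.x₁ t + ε • δ.x₁ t
  x₂ := fun t => p.x₂ t + ε • δ.x₂ t
  u₁ := fun t => p.u₁ t + ε • δ.u₁ t
  u₂ := fun t => p.u₂ t + ε • δ.u₂ t

/-- Directions of variation: arbitrary change `δτ` of the switching time, arbitrary continuous
control variations, arbitrary `C¹` state variations that respect the prescribed initial state and,
if there is one, the prescribed final state.  Neither the dynamics, nor continuity at the switch,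
nor the interface constraint is imposed on the variations. -/
structure IsVariation (P : SwitchedProblem n m) (δ : SwitchedProcess n m) : Prop where
  u₁_cont : Continuous δ.u₁
  u₂_cont : Continuous δ.u₂
  x₁_C1 : ContDiff ℝ 1 δ.x₁
  x₂_C1 : ContDiff ℝ 1 δ.x₂
  init : δ.x₁ P.t₀ = 0
  final : P.target ≠ none → δ.x₂ P.tf = 0

/-- `(a, lam₁, lam₂, ν, κ)` are Lagrange multipliers at `p`: the first variation of the augmented
cost at `p` vanishes in every direction. -/
def IsStationary (P : SwitchedProblem n m) (p : SwitchedProcess n m) (a : ℝ)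
    (lam₁ lam₂ : ℝ → EuclideanSpace ℝ (Fin n)) (ν : ℝ) (κ : EuclideanSpace ℝ (Fin n)) : Prop :=
  ∀ δ : SwitchedProcess n m, P.IsVariation δ →
    HasDerivAt (fun ε : ℝ => P.augmentedCost a lam₁ lam₂ ν κ (vary p δ ε)) 0 0

/-- `lam₁` (on `[t₀, τ]`) and `lam₂` (on `[τ, tf]`) form a co-state along `p`: they solve the
adjoint equations `λ̇ᵢ = -∂Hᵢ/∂x` on the open phases, and they are Lagrange multipliers of the
dynamics, the cost having multiplier one.  Since `lam₁`, `lam₂` are continuous, `lam₁ τ = λ(τ-)` and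
`lam₂ τ = λ(τ+)`. -/
structure IsCostate (P : SwitchedProblem n m) (p : SwitchedProcess n m)
    (lam₁ lam₂ : ℝ → EuclideanSpace ℝ (Fin n)) : Prop where
  cont₁ : Continuous lam₁
  cont₂ : Continuous lam₂
  adjoint₁ : ∀ t ∈ Set.Ioo P.t₀ p.τ,
    HasDerivAt lam₁ (-∇ (fun x => P.H₁ x (lam₁ t) (p.u₁ t) t) (p.x₁ t)) t
  adjoint₂ : ∀ t ∈ Set.Ioo p.τ P.tf,
    HasDerivAt lam₂ (-∇ (fun x => P.H₂ x (lam₂ t) (p.u₂ t) t) (p.x₂ t)) t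
  stationary : ∃ (ν : ℝ) (κ : EuclideanSpace ℝ (Fin n)), P.IsStationary p 1 lam₁ lam₂ ν κ

/-- `p` is normal: the only multipliers with cost multiplier zero have trivial co-state part. -/
def IsNormal (P : SwitchedProblem n m) (p : SwitchedProcess n m) : Prop :=
  ∀ (lam₁ lam₂ : ℝ → EuclideanSpace ℝ (Fin n)) (ν : ℝ) (κ : EuclideanSpace ℝ (Fin n)),
    Continuous lam₁ → Continuous lam₂ → P.IsStationary p 0 lam₁ lam₂ ν κ →
      (∀ t ∈ Set.Icc P.t₀ p.τ, lam₁ t = 0) ∧ (∀ t ∈ Set.Icc p.τ P.tf, lam₂ t = 0)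

/-- Value `f₁(τ)` along `p`. -/
def f₁At (P : SwitchedProblem n m) (p : SwitchedProcess n m) : EuclideanSpace ℝ (Fin n) :=
  P.f₁ (p.x₁ p.τ) (p.u₁ p.τ) p.τ

/-- Value `f₂(τ)` along `p`. -/
def f₂At (P : SwitchedProblem n m) (p : SwitchedProcess n m) : EuclideanSpace ℝ (Fin n) :=
  P.f₂ (p.x₂ p.τ) (p.u₂ p.τ) p.τ

/-- `ΔL = L₂(τ) - L₁(τ)`. -/
def jumpL (P : SwitchedProblem n m) (p : SwitchedProcess n m) : ℝ :=
  P.L₂ (p.x₂ p.τ) (p.u₂ p.τ) p.τ - P.L₁ (p.x₁ p.τ) (p.u₁ p.τ) p.τ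

/-- `Δf = f₂(τ) - f₁(τ)`. -/
def jumpf (P : SwitchedProblem n m) (p : SwitchedProcess n m) : EuclideanSpace ℝ (Fin n) :=
  P.f₂At p - P.f₁At p

/-- `⟨f⟩ = (f₁(τ) + f₂(τ)) / 2`. -/
def avgf (P : SwitchedProblem n m) (p : SwitchedProcess n m) : EuclideanSpace ℝ (Fin n) :=
  (1 / 2 : ℝ) • (P.f₂At p + P.f₁At p)

/-- The gradient of `g` at the switching state. -/
def normal (P : SwitchedProblem n m) (p : SwitchedProcess n m) : EuclideanSpace ℝ (Fin n) :=
  ∇ P.g (p.x₁ p.τ)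

end SwitchedProblem

end

/-! The jump law is linear algebra on three families of directions in the first variation with cost
weight `1`. Moving only the switching time gives `ν mᵀf₁ + κᵀΔf = ΔL`. Integrating by parts along
the adjoint equation, the variations of `x₁` and `x₂` that vanish at the outer ends give `λ₁(τ) = ν
m - κ` and `λ₂(τ) = -κ`. Hence `Δλ = -ν m`, and substituting `λ₁ + λ₂ = ν m - 2κ` into the first
equation yields `ν mᵀ⟨f⟩ = ΔL + ⟨λ⟩ᵀΔf`. This is `IsCostate.jump_eq`.

For existence, the sign of `g` before and after the switch forces `mᵀf₁ ≥ 0` and `mᵀf₂ ≥ 0`, so a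
transversal crossing makes both positive and `mᵀ⟨f⟩ > 0`. The problem is then rewritten as a
minimization on a Banach space. Each phase lives on all of `[t₀, tf]` and has as coordinates an
offset, the velocity and the control; the state is a primitive, based at `t₀` in phase 1 and at `tf`
in phase 2. The offset ranges over a subspace `S`: `⊥` fixes the base value, `⊤` frees it. Dynamics,
interface condition and continuity at the switch become a strictly differentiable map into `C × C ×
ℝ × ℝⁿ`. Transversality makes the strict inequalities for `g` stable
(`Admissible.eventually_admissible`), so an optimal process is a local minimum on a level set of
this map, and the Lagrange multiplier rule applies.

The multiplier is only an algebraic functional. No continuity is needed to represent it: the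
linearized dynamics are solvable for every right-hand side `h`, so the multiplier identity computes
the functional at `h`, and an adjoint solution turns the result into `-∫ ⟨λ, h⟩`
(`exists_adjoint_representation`). If the cost weight is zero, a free final state makes every
multiplier vanish, and a prescribed one leaves a nonzero co-state that contradicts normality.
Otherwise the weight is scaled to `1`. -/

/-! ### Ordinary differential equations -/

section ODE

open Set Metric
open scoped NNReal Topology

variable {E : Type*} [NormedAddCommGroup E] [NormedSpace ℝ E]

theorem HasDerivAt.comp_neg_fun {y : ℝ → E} {y' : E} {t : ℝ} (hy : HasDerivAt y y' (-t)) :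
    HasDerivAt (fun r => y (-r)) (-y') t := by
  have := hy.scomp t (hasDerivAt_neg t)
  rwa [neg_one_smul] at this

/-- Two-sided Grönwall bound. -/
theorem norm_le_gronwallBound_of_hasDerivAt {y y' : ℝ → E} {a b M C s t : ℝ}
    (hM : 0 ≤ M) (hC : 0 ≤ C) (hy : ∀ r ∈ Icc a b, HasDerivAt y (y' r) r)
    (hb : ∀ r ∈ Icc a b, ‖y' r‖ ≤ M * ‖y r‖ + C) (hs : s ∈ Icc a b) (ht : t ∈ Icc a b) :
    ‖y t‖ ≤ gronwallBound ‖y s‖ M C (b - a) := by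
  rcases le_total s t with hst | hts
  · refine (norm_le_gronwallBound_of_norm_deriv_right_le (a := s) (b := t) (f := y) (f' := y')
      (fun r hr => (hy r ⟨hs.1.trans hr.1, hr.2.trans ht.2⟩).continuousAt.continuousWithinAt)
      (fun r hr => (hy r ⟨hs.1.trans hr.1, hr.2.le.trans ht.2⟩).hasDerivWithinAt) le_rfl
      (fun r hr => hb r ⟨hs.1.trans hr.1, hr.2.le.trans ht.2⟩) t ⟨hst, le_rfl⟩).trans ?_
    exact gronwallBound_mono (norm_nonneg _) hC hM (by linarith [hs.1, ht.2])
  · have hneg : ∀ r, -r ∈ Icc a b → HasDerivAt (fun r => y (-r)) (-y' (-r)) r := by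
      exact fun r hr => (hy (-r) hr).comp_neg_fun
    have hmem : ∀ r ∈ Icc (-s) (-t), -r ∈ Icc a b := fun r hr =>
      ⟨by linarith [hr.2, ht.1], by linarith [hr.1, hs.2]⟩
    have := norm_le_gronwallBound_of_norm_deriv_right_le (a := -s) (b := -t)
      (f := fun r => y (-r)) (f' := fun r => -y' (-r)) (δ := ‖y s‖) (K := M) (ε := C)
      (fun r hr => (hneg r (hmem r hr)).continuousAt.continuousWithinAt)
      (fun r hr => (hneg r (hmem r ⟨hr.1, hr.2.le⟩)).hasDerivWithinAt) (by simp)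
      (fun r hr => by simpa using hb (-r) (hmem r ⟨hr.1, hr.2.le⟩)) (-t) ⟨by linarith, le_rfl⟩
    simp only [neg_neg] at this
    exact this.trans (gronwallBound_mono (norm_nonneg _) hC hM (by linarith [ht.1, hs.2]))

/-- Local solvability of an initial value problem whose right-hand side is continuous and has a
jointly continuous derivative in the state. -/
theorem exists_local_ode_solution [ProperSpace E] {F : ℝ → E → E} {F' : ℝ → E → E →L[ℝ] E}
    (hF : Continuous fun q : ℝ × E => F q.1 q.2)
    (hF' : Continuous fun q : ℝ × E => F' q.1 q.2)
    (hd : ∀ t x, HasFDerivAt (F t) (F' t x) x) (s : ℝ) (c : E) :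
    ∃ η > 0, ∃ y : ℝ → E, y s = c ∧ ∀ t ∈ Icc (s - η) (s + η), HasDerivAt y (F t (y t)) t := by
  have hK : IsCompact (Icc (s - 1) (s + 1) ×ˢ closedBall c 1) :=
    isCompact_Icc.prod (isCompact_closedBall c 1)
  obtain ⟨L, hL⟩ := hK.exists_bound_of_continuousOn hF.continuousOn
  obtain ⟨K, hK⟩ := hK.exists_bound_of_continuousOn hF'.continuousOn
  have h0 : (s, c) ∈ Icc (s - 1) (s + 1) ×ˢ closedBall c 1 := by simp
  have hL0 : 0 ≤ L := (norm_nonneg _).trans (hL _ h0)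
  have hK0 : 0 ≤ K := (norm_nonneg _).trans (hK _ h0)
  -- A curve of speed at most `L` stays in the unit ball around `c` during time `ε`.
  obtain ⟨ε, hε, hε1, hεL⟩ : ∃ ε : ℝ, 0 < ε ∧ ε ≤ 1 ∧ L * ε ≤ 1 := by
    refine ⟨1 / (L + 1), by positivity, ?_, ?_⟩
    · rw [div_le_one (by positivity)]; linarith
    · rw [mul_one_div, div_le_one (by positivity)]; linarith
  have hsub : ∀ t ∈ Icc (s - ε) (s + ε), t ∈ Icc (s - 1) (s + 1) := fun t ht =>
    ⟨by linarith [ht.1], by linarith [ht.2]⟩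
  have hPL : IsPicardLindelof F (⟨s, by simp [hε.le]⟩ : Icc (s - ε) (s + ε)) c 1 0
      ⟨L, hL0⟩ ⟨K, hK0⟩ := by
    refine ⟨fun t ht => ?_, fun x _ => ?_, fun t ht x hx => hL (t, x) ⟨hsub t ht, hx⟩, ?_⟩
    · refine Convex.lipschitzOnWith_of_nnnorm_hasFDerivWithin_le (𝕜 := ℝ)
        (fun x _ => (hd t x).hasFDerivWithinAt) (fun x hx => ?_) (convex_closedBall c _)
      exact hK (t, x) ⟨hsub t ht, hx⟩
    · exact (hF.comp (by fun_prop : Continuous fun t : ℝ => (t, x))).continuousOn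
    · change L * max (s + ε - s) (s - (s - ε)) ≤ (1 : ℝ) - 0
      rw [add_sub_cancel_left, sub_sub_cancel, max_self, sub_zero]
      exact hεL
  obtain ⟨α, hα0, hα⟩ := hPL.exists_eq_forall_mem_Icc_hasDerivWithinAt₀
  exact ⟨ε / 2, by positivity, α, hα0, fun t ht =>
    (hα t ⟨by linarith [ht.1], by linarith [ht.2]⟩).hasDerivAt
      (Icc_mem_nhds (by linarith [ht.1]) (by linarith [ht.2]))⟩

/-- A `C¹` solution on `[a, s]` extends to a `C¹` function that is a solution beyond `s`. -/
theorem exists_ode_extension_right [ProperSpace E] {F : ℝ → E → E} {F' : ℝ → E → E →L[ℝ] E}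
    (hF : Continuous fun q : ℝ × E => F q.1 q.2)
    (hF' : Continuous fun q : ℝ × E => F' q.1 q.2)
    (hd : ∀ t x, HasFDerivAt (F t) (F' t x) x) {x : ℝ → E} {a s : ℝ} (has : a ≤ s)
    (hx : ContDiff ℝ 1 x) (hode : ∀ t ∈ Icc a s, HasDerivAt x (F t (x t)) t) :
    ∃ η > 0, ∃ y : ℝ → E, ContDiff ℝ 1 y ∧ (∀ t ≤ s, y t = x t) ∧
      ∀ t ∈ Icc a (s + η), HasDerivAt y (F t (y t)) t := by
  have : CompleteSpace E := inferInstance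
  obtain ⟨η, hη, α, hα0, hα⟩ := exists_local_ode_solution hF hF' hd s (x s)
  have hx' : Continuous (deriv x) := hx.continuous_deriv le_rfl
  have hxd : ∀ t, HasDerivAt x (deriv x t) t := fun t =>
    (hx.differentiable one_ne_zero t).hasDerivAt
  have hαc : ContinuousOn α (Icc s (s + η)) := fun t ht =>
    (hα t ⟨by linarith [ht.1], ht.2⟩).continuousAt.continuousWithinAt
  have hse : s ≤ s + η := by linarith
  -- Freezing `α` outside its interval makes it continuous on all of `ℝ`.
  set β : ℝ → E := IccExtend hse ((Icc s (s + η)).domRestrict α) with hβ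
  have hβc : Continuous β := (continuousOn_iff_continuous_domRestrict.1 hαc).Icc_extend'
  have hβα : ∀ t ∈ Icc s (s + η), β t = α t := fun t ht => by
    rw [hβ, IccExtend_of_mem _ _ ht]; rfl
  -- Velocities are glued instead of states. The two branches agree at `s` because both equal `F s
  -- (x s)`, so the primitive `y` of `w` is `C¹` at once.
  set w : ℝ → E := fun t => if t ≤ s then deriv x t else F t (β t) with hw
  have hwc : Continuous w := by
    refine Continuous.if_le hx' (hF.comp (continuous_id.prodMk hβc)) continuous_id
      continuous_const fun t ht => ?_
    change t = s at ht
    subst ht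
    rw [(hode t ⟨has, le_rfl⟩).deriv, hβα t ⟨le_rfl, by linarith⟩, hα0]
  set y : ℝ → E := fun t => x s + ∫ r in s..t, w r with hy
  have hyd : ∀ t, HasDerivAt y (w t) t := fun t =>
    (intervalIntegral.integral_hasDerivAt_right (hwc.intervalIntegrable _ _)
      hwc.stronglyMeasurable.stronglyMeasurableAtFilter hwc.continuousAt).const_add _
  have hy1 : ∀ t ≤ s, y t = x t := fun t ht => by
    have h1 : ∫ r in s..t, w r = ∫ r in s..t, deriv x r :=
      intervalIntegral.integral_congr fun r hr => by
        rw [uIcc_of_ge ht] at hr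
        simp [hw, hr.2]
    rw [hy]
    dsimp only
    rw [h1, intervalIntegral.integral_deriv_eq_sub' x rfl
      (fun r _ => (hxd r).differentiableAt) hx'.continuousOn]
    abel
  have hy2 : ∀ t ∈ Icc s (s + η), y t = α t := fun t ht => by
    have h1 : ∫ r in s..t, w r = ∫ r in s..t, F r (β r) := by
      refine intervalIntegral.integral_congr fun r hr => ?_
      rw [uIcc_of_le ht.1] at hr
      by_cases hrs : r ≤ s
      · have hr' : r = s := le_antisymm hrs hr.1
        subst hr'
        simp only [hw, le_refl, if_true]
        rw [(hode r ⟨has, le_rfl⟩).deriv, hβα r ⟨le_rfl, by linarith⟩, hα0]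
      · simp [hw, hrs]
    have h2 : ∫ r in s..t, F r (β r) = α t - α s := by
      refine intervalIntegral.integral_eq_sub_of_hasDerivAt (fun r hr => ?_)
        (hF.comp (continuous_id.prodMk hβc)).continuousOn.intervalIntegrable
      rw [uIcc_of_le ht.1] at hr
      rw [hβα r ⟨hr.1, hr.2.trans ht.2⟩]
      exact hα r ⟨by linarith [hr.1], hr.2.trans ht.2⟩
    rw [hy]
    dsimp only
    rw [h1, h2, hα0]
    abel
  refine ⟨η, hη, y, ?_, hy1, fun t ht => ?_⟩
  · refine contDiff_one_iff_deriv.2 ⟨fun t => (hyd t).differentiableAt, ?_⟩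
    rwa [funext fun t => (hyd t).deriv]
  · convert hyd t using 1
    by_cases hts : t ≤ s
    · simp only [hw, hts, if_true]
      rw [(hode t ⟨ht.1, hts⟩).deriv, hy1 t hts]
    · have ht' : t ∈ Icc s (s + η) := ⟨(not_le.1 hts).le, ht.2⟩
      simp only [hw, hts, if_false]
      rw [hβα t ht', hy2 t ht']

/-- A `C¹` solution on `[s, b]` extends to a `C¹` function that is a solution before `s`. -/
theorem exists_ode_extension_left [ProperSpace E] {F : ℝ → E → E} {F' : ℝ → E → E →L[ℝ] E}
    (hF : Continuous fun q : ℝ × E => F q.1 q.2)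
    (hF' : Continuous fun q : ℝ × E => F' q.1 q.2)
    (hd : ∀ t x, HasFDerivAt (F t) (F' t x) x) {x : ℝ → E} {b s : ℝ} (hsb : s ≤ b)
    (hx : ContDiff ℝ 1 x) (hode : ∀ t ∈ Icc s b, HasDerivAt x (F t (x t)) t) :
    ∃ η > 0, ∃ y : ℝ → E, ContDiff ℝ 1 y ∧ (∀ t, s ≤ t → y t = x t) ∧
      ∀ t ∈ Icc (s - η) b, HasDerivAt y (F t (y t)) t := by
  obtain ⟨η, hη, y, hy, hyx, hyode⟩ := exists_ode_extension_right
    (F := fun t x => -F (-t) x) (F' := fun t x => -F' (-t) x) (x := fun t => x (-t))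
    (a := -b) (s := -s)
    (hF.comp (by fun_prop : Continuous fun q : ℝ × E => (-q.1, q.2))).neg
    (hF'.comp (by fun_prop : Continuous fun q : ℝ × E => (-q.1, q.2))).neg
    (fun t x => (hd (-t) x).neg) (by linarith) (hx.comp contDiff_neg)
    (fun t ht => (hode (-t) ⟨by linarith [ht.2], by linarith [ht.1]⟩).comp_neg_fun)
  refine ⟨η, hη, fun t => y (-t), hy.comp contDiff_neg, fun t ht => ?_, fun t ht => ?_⟩
  · beta_reduce
    rw [hyx (-t) (by linarith), neg_neg]
  · simpa using (hyode (-t) ⟨by linarith [ht.2], by linarith [ht.1]⟩).comp_neg_fun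

variable [FiniteDimensional ℝ E]

/-- A Lipschitz map that is the identity on a ball, does not increase norms and is bounded. -/
theorem exists_lipschitz_truncation (R : ℝ) (hR : 0 < R) :
    ∃ (ρ : E → E) (K : ℝ≥0), LipschitzWith K ρ ∧ (∀ y, ‖y‖ ≤ R → ρ y = y) ∧
      (∀ y, ‖ρ y‖ ≤ ‖y‖) ∧ ∀ y, ‖ρ y‖ ≤ 2 * R := by
  let χ : ContDiffBump (0 : E) := ⟨R, 2 * R, hR, by linarith⟩
  have hs : HasCompactSupport (fun y : E => χ y • y) := χ.hasCompactSupport.smul_right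
  have hc : ContDiff ℝ 1 (fun y : E => χ y • y) := χ.contDiff.smul contDiff_id
  obtain ⟨K, hK⟩ := hc.lipschitzWith_of_hasCompactSupport hs (by simp)
  have h1 : ∀ y, ‖χ y • y‖ ≤ ‖y‖ := fun y => by
    rw [norm_smul, Real.norm_of_nonneg χ.nonneg]
    exact mul_le_of_le_one_left (norm_nonneg _) χ.le_one
  refine ⟨fun y => χ y • y, K, hK, fun y hy => ?_, h1, fun y => ?_⟩
  · beta_reduce
    rw [χ.one_of_mem_closedBall (by simpa [χ] using hy), one_smul]
  · by_cases hy : ‖y‖ ≤ 2 * R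
    · exact (h1 y).trans hy
    · beta_reduce
      rw [χ.zero_of_le_dist (by simpa [χ] using (not_le.1 hy).le), zero_smul, norm_zero]
      positivity

/-- Linear differential equations with continuous coefficients are solvable on every compact
interval, with arbitrary data at an arbitrary time. -/
theorem exists_linear_ode_solution {A : ℝ → E →L[ℝ] E} {h : ℝ → E} (hA : Continuous A)
    (hh : Continuous h) {a b s : ℝ} (hs : s ∈ Icc a b) (c : E) :
    ∃ y : ℝ → E, Continuous y ∧ y s = c ∧ ∀ t ∈ Icc a b, HasDerivAt y (A t (y t) + h t) t := by
  have : CompleteSpace E := FiniteDimensional.complete ℝ E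
  have hab : a - 1 ≤ b + 1 := by linarith [hs.1, hs.2]
  obtain ⟨M, hM⟩ := (isCompact_Icc (a := a - 1) (b := b + 1)).exists_bound_of_continuousOn
    hA.continuousOn
  obtain ⟨C, hC⟩ := (isCompact_Icc (a := a - 1) (b := b + 1)).exists_bound_of_continuousOn
    hh.continuousOn
  have hM0 : 0 ≤ M := (norm_nonneg _).trans (hM (a - 1) ⟨le_rfl, hab⟩)
  have hC0 : 0 ≤ C := (norm_nonneg _).trans (hC (a - 1) ⟨le_rfl, hab⟩)
  -- Composing the linear part with a truncation `ρ` makes the right-hand side bounded and globally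
  -- Lipschitz, so Picard–Lindelöf covers the whole interval. Since `‖ρ y‖ ≤ ‖y‖`, Grönwall bounds
  -- the truncated solution by the same constant as the linear one; with this `R` it stays where `ρ`
  -- is the identity. The margin of `1` on each side provides two-sided derivatives at `a` and `b`.
  set R : ℝ := max 1 (gronwallBound ‖c‖ M C (b - a)) with hR
  have hR0 : 0 < R := lt_of_lt_of_le one_pos (le_max_left _ _)
  obtain ⟨ρ, K, hρ, hρ1, hρ2, hρ3⟩ := exists_lipschitz_truncation (E := E) R hR0
  have hs' : s ∈ Icc (a - 1) (b + 1) := ⟨by linarith [hs.1], by linarith [hs.2]⟩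
  let L : ℝ≥0 := ⟨M * (2 * R) + C, by positivity⟩
  let D : ℝ≥0 := ⟨(M * (2 * R) + C) * (b + 1 - (a - 1)),
    mul_nonneg (by positivity) (by linarith)⟩
  have hPL : IsPicardLindelof (fun t y => A t (ρ y) + h t) (⟨s, hs'⟩ : Icc (a - 1) (b + 1)) c
      D 0 L (⟨M, hM0⟩ * K) := by
    refine ⟨fun t ht => ?_, fun y _ => ?_, fun t ht y _ => ?_, ?_⟩
    · refine LipschitzWith.lipschitzOnWith (LipschitzWith.of_dist_le_mul fun y z => ?_)
      rw [dist_add_right, dist_eq_norm, ← map_sub]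
      refine ((A t).le_opNorm _).trans ?_
      change _ ≤ M * K * dist y z
      rw [mul_assoc]
      refine mul_le_mul (hM t ht) ?_ (norm_nonneg _) hM0
      rw [← dist_eq_norm]
      exact hρ.dist_le_mul y z
    · exact ((hA.clm_apply continuous_const).add hh).continuousOn
    · refine (norm_add_le _ _).trans (add_le_add ?_ (hC t ht))
      refine ((A t).le_opNorm _).trans ?_
      exact mul_le_mul (hM t ht) (hρ3 y) (norm_nonneg _) hM0
    · change (M * (2 * R) + C) * _ ≤ (M * (2 * R) + C) * (b + 1 - (a - 1)) - 0
      rw [sub_zero]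
      refine mul_le_mul_of_nonneg_left (max_le ?_ ?_) (by positivity)
      · change b + 1 - s ≤ _
        linarith [hs'.1]
      · change s - (a - 1) ≤ _
        linarith [hs'.2]
  obtain ⟨α, hα0, hα⟩ := hPL.exists_eq_forall_mem_Icc_hasDerivWithinAt₀
  have hd : ∀ t ∈ Icc a b, HasDerivAt α (A t (ρ (α t)) + h t) t := fun t ht =>
    (hα t ⟨by linarith [ht.1], by linarith [ht.2]⟩).hasDerivAt
      (Icc_mem_nhds (by linarith [ht.1]) (by linarith [ht.2]))
  have hbound : ∀ t ∈ Icc a b, ‖α t‖ ≤ R := fun t ht => by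
    have := norm_le_gronwallBound_of_hasDerivAt hM0 hC0 hd (fun r hr => ?_) hs ht
    · rw [show α s = c from hα0] at this
      exact this.trans (le_max_right _ _)
    · have hr' : r ∈ Icc (a - 1) (b + 1) := ⟨by linarith [hr.1], by linarith [hr.2]⟩
      refine (norm_add_le _ _).trans (add_le_add ?_ (hC r hr'))
      exact ((A r).le_opNorm _).trans (mul_le_mul (hM r hr') (hρ2 _) (norm_nonneg _) hM0)
  have hd' : ∀ t ∈ Icc a b, HasDerivAt α (A t (α t) + h t) t := fun t ht => by
    simpa [hρ1 _ (hbound t ht)] using hd t ht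
  have hcont : ContinuousOn α (Icc (a - 1) (b + 1)) := fun t ht => (hα t ht).continuousWithinAt
  refine ⟨IccExtend hab ((Icc (a - 1) (b + 1)).domRestrict α),
    (continuousOn_iff_continuous_domRestrict.1 hcont).Icc_extend', ?_, fun t ht => ?_⟩
  · rw [IccExtend_of_mem _ _ hs']; exact hα0
  · have ht' : t ∈ Icc (a - 1) (b + 1) := ⟨by linarith [ht.1], by linarith [ht.2]⟩
    rw [IccExtend_of_mem _ _ ht']
    refine (hd' t ht).congr_of_eventuallyEq ?_
    filter_upwards [Icc_mem_nhds (show a - 1 < t by linarith [ht.1])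
      (show t < b + 1 by linarith [ht.2])] with r hr
    rw [IccExtend_of_mem _ _ hr]; rfl

end ODE

/-! ### Strict differentiability of integral and superposition operators -/

section Operators

open Set Metric MeasureTheory Filter
open scoped Topology

variable {V Z : Type*} [NormedAddCommGroup V] [NormedAddCommGroup Z] {a b : ℝ} (hab : a ≤ b)

theorem continuous_iccExtend (h : C(Icc a b, V)) : Continuous (IccExtend hab h) :=
  h.continuous.Icc_extend'

theorem continuous_iccExtend_uncurry :
    Continuous fun q : ℝ × C(Icc a b, V) => IccExtend hab q.2 q.1 := by
  change Continuous fun q : ℝ × C(Icc a b, V) => q.2 (projIcc a b hab q.1)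
  exact continuous_snd.eval (continuous_projIcc.comp continuous_fst)

theorem norm_iccExtend_le (h : C(Icc a b, V)) (t : ℝ) :
    ‖IccExtend hab h t‖ ≤ ‖h‖ := h.norm_coe_le_norm _

/-- The superposition operator `z ↦ F (z ·) ·` on `C([a, b], Z)`. -/
def nemytskii {F : Z → ℝ → V} (hF : Continuous fun q : Z × ℝ => F q.1 q.2) (z : C(Icc a b, Z)) :
    C(Icc a b, V) :=
  ⟨fun t => F (z t) t, hF.comp (z.continuous.prodMk continuous_subtype_val)⟩

@[simp]
theorem nemytskii_apply {F : Z → ℝ → V} (hF : Continuous fun q : Z × ℝ => F q.1 q.2)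
    (z : C(Icc a b, Z)) (t : Icc a b) : nemytskii hF z t = F (z t) t := rfl

variable [NormedSpace ℝ V] [NormedSpace ℝ Z]

/-- Integration from `s` to `t` as a continuous linear map on `C([a, b], V)`. -/
noncomputable def integralCLM (s t : ℝ) : C(Icc a b, V) →L[ℝ] V :=
  LinearMap.mkContinuous
    { toFun := fun h => ∫ r in s..t, IccExtend hab h r
      map_add' := fun h k => intervalIntegral.integral_add
        ((continuous_iccExtend hab h).intervalIntegrable _ _)
        ((continuous_iccExtend hab k).intervalIntegrable _ _)
      map_smul' := fun c h => intervalIntegral.integral_smul c _ } |t - s| fun h => by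
    rw [mul_comm]
    exact intervalIntegral.norm_integral_le_of_norm_le_const fun r _ => norm_iccExtend_le hab h r

@[simp]
theorem integralCLM_apply (s t : ℝ) (h : C(Icc a b, V)) :
    integralCLM hab s t h = ∫ r in s..t, IccExtend hab h r := rfl

/-- Pointwise application of a continuous family of linear maps. -/
noncomputable def pointwiseCLM (A : C(Icc a b, Z →L[ℝ] V)) : C(Icc a b, Z) →L[ℝ] C(Icc a b, V) :=
  LinearMap.mkContinuous
    { toFun := fun z => ⟨fun t => A t (z t), A.continuous.clm_apply z.continuous⟩
      map_add' := fun z w => ContinuousMap.ext fun t => map_add (A t) (z t) (w t)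
      map_smul' := fun c z => ContinuousMap.ext fun t => map_smul (A t) c (z t) }
    ‖A‖ fun z => by
    refine (ContinuousMap.norm_le _ (by positivity)).2 fun t => ?_
    exact ((A t).le_opNorm _).trans (mul_le_mul (A.norm_coe_le_norm t) (z.norm_coe_le_norm t)
      (norm_nonneg _) (norm_nonneg A))

@[simp]
theorem pointwiseCLM_apply (A : C(Icc a b, Z →L[ℝ] V)) (z : C(Icc a b, Z)) (t : Icc a b) :
    pointwiseCLM A z t = A t (z t) := rfl

/-- Superposition operators with jointly continuous derivative are strictly differentiable. -/
theorem hasStrictFDerivAt_nemytskii {F : Z → ℝ → V} {F' : Z → ℝ → Z →L[ℝ] V}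
    (hF : Continuous fun q : Z × ℝ => F q.1 q.2) (hF' : Continuous fun q : Z × ℝ => F' q.1 q.2)
    (hd : ∀ z t, HasFDerivAt (fun z => F z t) (F' z t) z) (z₀ : C(Icc a b, Z)) :
    HasStrictFDerivAt (nemytskii hF) (pointwiseCLM (nemytskii hF' z₀)) z₀ := by
  rw [hasStrictFDerivAt_iff_isLittleO, Asymptotics.isLittleO_iff]
  intro c hc
  -- Compactness of `[a, b]` makes the continuity of `F'` along `z₀` uniform in time; the mean value
  -- inequality at each `t` then gives an estimate in the sup norm.
  have hev : ∀ᶠ y : Z in 𝓝 0, ∀ t ∈ (univ : Set (Icc a b)),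
      ‖F' (z₀ t + y) t - F' (z₀ t) t‖ < c := by
    refine isCompact_univ.eventually_forall_of_forall_eventually fun t _ => ?_
    have hcont : Continuous fun q : Z × Icc a b => ‖F' (z₀ q.2 + q.1) q.2 - F' (z₀ q.2) q.2‖ :=
      ((hF'.comp (f := fun q : Z × Icc a b => (z₀ q.2 + q.1, (q.2 : ℝ))) (by fun_prop)).sub
        (hF'.comp (f := fun q : Z × Icc a b => (z₀ q.2, (q.2 : ℝ))) (by fun_prop))).norm
    refine (hcont.tendsto (0, t)).eventually (gt_mem_nhds ?_)
    simpa using hc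
  obtain ⟨δ, hδ, hball⟩ := Metric.eventually_nhds_iff_ball.1 hev
  have hnear : ∀ᶠ z in 𝓝 z₀, z ∈ ball z₀ δ := ball_mem_nhds _ hδ
  rw [nhds_prod_eq]
  filter_upwards [hnear.prod_mk hnear]
  rintro ⟨z, z'⟩ ⟨hz, hz'⟩
  refine (ContinuousMap.norm_le _ (by positivity)).2 fun t => ?_
  have hmem : ∀ w : C(Icc a b, Z), w ∈ ball z₀ δ → w t ∈ ball (z₀ t) δ := fun w hw =>
    (ContinuousMap.dist_apply_le_dist t).trans_lt hw
  have := (convex_ball (z₀ t) δ).norm_image_sub_le_of_norm_hasFDerivWithin_le' (C := c)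
    (f := fun y => F y t) (f' := fun y => F' y t) (φ := F' (z₀ t) t)
    (fun y _ => (hd y t).hasFDerivWithinAt) (fun y hy => ?_) (hmem z' hz') (hmem z hz)
  · refine this.trans (mul_le_mul_of_nonneg_left ?_ hc.le)
    exact (z - z').norm_coe_le_norm t
  · have := hball (y - z₀ t) (by simpa [dist_eq_norm] using hy) t (mem_univ _)
    rw [add_sub_cancel] at this
    exact this.le

variable [CompleteSpace V]

theorem hasDerivAt_integral_iccExtend (s t : ℝ) (h : C(Icc a b, V)) :
    HasDerivAt (fun r => ∫ u in s..r, IccExtend hab h u) (IccExtend hab h t) t :=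
  intervalIntegral.integral_hasDerivAt_right
    ((continuous_iccExtend hab h).intervalIntegrable _ _)
    (continuous_iccExtend hab h).stronglyMeasurable.stronglyMeasurableAtFilter
    (continuous_iccExtend hab h).continuousAt

/-- The primitive vanishing at `s` as a continuous linear map on `C([a, b], V)`. -/
noncomputable def primitiveCLM (s : ℝ) : C(Icc a b, V) →L[ℝ] C(Icc a b, V) :=
  LinearMap.mkContinuous
    { toFun := fun h => ⟨fun t => integralCLM hab s t h, by
        exact (continuous_iff_continuousAt.2 fun t =>
          (hasDerivAt_integral_iccExtend hab s t h).continuousAt).comp continuous_subtype_val⟩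
      map_add' := fun h k => ContinuousMap.ext fun t => map_add (integralCLM hab s t) h k
      map_smul' := fun c h => ContinuousMap.ext fun t => map_smul (integralCLM hab s t) c h }
    (|a - s| + |b - s|) fun h => by
    refine (ContinuousMap.norm_le _ (by positivity)).2 fun t => ?_
    refine (intervalIntegral.norm_integral_le_of_norm_le_const
      fun r _ => norm_iccExtend_le hab h r).trans ?_
    rw [mul_comm]
    refine mul_le_mul_of_nonneg_right ?_ (norm_nonneg _)
    obtain ⟨ht1, ht2⟩ := t.2
    rw [abs_le]
    constructor <;> linarith [neg_abs_le (a - s), abs_nonneg (b - s), le_abs_self (b - s),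
      abs_nonneg (a - s)]

@[simp]
theorem primitiveCLM_apply (s : ℝ) (h : C(Icc a b, V)) (t : Icc a b) :
    primitiveCLM hab s h t = ∫ r in s..t, IccExtend hab h r := rfl

/-- Joint strict differentiability of the integral in the upper limit and the integrand. -/
theorem hasStrictFDerivAt_integral_IccExtend (s τ : ℝ) (h₀ : C(Icc a b, V)) :
    HasStrictFDerivAt (fun q : ℝ × C(Icc a b, V) => ∫ t in s..q.1, IccExtend hab q.2 t)
      ((ContinuousLinearMap.fst ℝ ℝ C(Icc a b, V)).smulRight (IccExtend hab h₀ τ) +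
        (integralCLM hab s τ).comp (ContinuousLinearMap.snd ℝ ℝ C(Icc a b, V))) (τ, h₀) := by
  rw [hasStrictFDerivAt_iff_isLittleO, Asymptotics.isLittleO_iff]
  intro c hc
  have hcont := (continuous_iccExtend_uncurry (V := V) hab).tendsto (τ, h₀)
  have hnear := hcont.eventually (closedBall_mem_nhds _ (half_pos hc))
  rw [nhds_prod_eq, eventually_prod_iff] at hnear
  obtain ⟨p, hp, q, hq, hpq⟩ := hnear
  obtain ⟨δ, hδ, hδp⟩ := Metric.eventually_nhds_iff_ball.1 hp
  have hT : ∀ᶠ T in 𝓝 τ, T ∈ ball τ (min δ (c / 2)) :=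
    ball_mem_nhds _ (lt_min hδ (half_pos hc))
  have hev : ∀ᶠ z : ℝ × C(Icc a b, V) in 𝓝 (τ, h₀), z.1 ∈ ball τ (min δ (c / 2)) ∧ q z.2 := by
    rw [nhds_prod_eq]
    exact hT.prod_mk hq
  rw [nhds_prod_eq]
  filter_upwards [hev.prod_mk hev]
  rintro ⟨⟨T, h⟩, ⟨T', h'⟩⟩ ⟨⟨hT1, hh⟩, ⟨hT'1, _⟩⟩
  dsimp only at hT1 hh hT'1
  have hi : ∀ (k : C(Icc a b, V)) (u v : ℝ), IntervalIntegrable (IccExtend hab k) volume u v :=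
    fun k u v => (continuous_iccExtend hab k).intervalIntegrable _ _
  -- The exact remainder: the oscillation of the integrand on the short interval from `T'` to `T`,
  -- plus the integral of `h - h'` over the short interval from `τ` to `T'`. Each carries a factor
  -- `c / 2`.
  have key : (∫ t in s..T, IccExtend hab h t) - (∫ t in s..T', IccExtend hab h' t) -
      ((T - T') • IccExtend hab h₀ τ + integralCLM hab s τ (h - h')) =
      (∫ t in T'..T, (IccExtend hab h t - IccExtend hab h₀ τ)) +
        integralCLM hab τ T' (h - h') := by
    rw [map_sub, map_sub, intervalIntegral.integral_sub (hi _ _ _) (by simp),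
      intervalIntegral.integral_const]
    simp only [integralCLM_apply]
    rw [← intervalIntegral.integral_add_adjacent_intervals (hi h s τ) (hi h τ T),
      ← intervalIntegral.integral_add_adjacent_intervals (hi h τ T') (hi h T' T),
      ← intervalIntegral.integral_add_adjacent_intervals (hi h' s τ) (hi h' τ T')]
    abel
  have b1 : ‖∫ t in T'..T, (IccExtend hab h t - IccExtend hab h₀ τ)‖ ≤ c / 2 * |T - T'| := by
    refine intervalIntegral.norm_integral_le_of_norm_le_const fun t ht => ?_
    have htb : t ∈ ball τ (min δ (c / 2)) := by
      rw [Real.ball_eq_Ioo] at hT1 hT'1 ⊢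
      exact (ordConnected_Ioo.uIcc_subset hT'1 hT1) (uIoc_subset_uIcc ht)
    have := hpq (hδp t (ball_subset_ball (min_le_left _ _) htb)) hh
    rwa [dist_eq_norm] at this
  have b2 : ‖integralCLM hab τ T' (h - h')‖ ≤ c / 2 * ‖h - h'‖ := by
    refine (intervalIntegral.norm_integral_le_of_norm_le_const
      fun r _ => norm_iccExtend_le hab (h - h') r).trans ?_
    rw [mul_comm]
    refine mul_le_mul_of_nonneg_right ?_ (norm_nonneg _)
    have := (mem_ball.1 hT'1).le.trans (min_le_right _ _)
    rwa [Real.dist_eq] at this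
  change ‖(∫ t in s..T, IccExtend hab h t) - (∫ t in s..T', IccExtend hab h' t) -
      ((T - T') • IccExtend hab h₀ τ + integralCLM hab s τ (h - h'))‖ ≤ c * ‖(T - T', h - h')‖
  rw [key]
  have c1 : |T - T'| ≤ ‖(T - T', h - h')‖ := norm_fst_le (T - T', h - h')
  have c2 : ‖h - h'‖ ≤ ‖(T - T', h - h')‖ := norm_snd_le (T - T', h - h')
  refine (norm_add_le _ _).trans ((add_le_add b1 b2).trans ?_)
  nlinarith

/-- Differentiation of an integral whose integrand and upper limit depend on a parameter. -/
theorem hasDerivAt_integral_of_param {l l' : ℝ → ℝ → V}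
    (hl : Continuous fun q : ℝ × ℝ => l q.1 q.2) (hl' : Continuous fun q : ℝ × ℝ => l' q.1 q.2)
    (hd : ∀ ε t, HasDerivAt (fun ε => l ε t) (l' ε t) ε) (s τ d : ℝ) :
    HasDerivAt (fun ε => ∫ t in s..τ + ε * d, l ε t) (d • l 0 τ + ∫ t in s..τ, l' 0 t) 0 := by
  set a := min s τ - 1 with ha
  set b := max s τ + 1 with hb
  have hs : s ∈ Icc a b := ⟨by linarith [min_le_left s τ], by linarith [le_max_left s τ]⟩
  have hτ : τ ∈ Ioo a b := ⟨by linarith [min_le_right s τ], by linarith [le_max_right s τ]⟩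
  have hab : a ≤ b := hs.1.trans hs.2
  let l'' : ℝ → ℝ → ℝ →L[ℝ] V := fun ε t => ContinuousLinearMap.toSpanSingleton ℝ (l' ε t)
  have hl'' : Continuous fun q : ℝ × ℝ => l'' q.1 q.2 :=
    (ContinuousLinearMap.toSpanSingletonCLE (𝕜 := ℝ) (E := V)).continuous.comp hl'
  have hd'' : ∀ ε t, HasFDerivAt (fun ε => l ε t) (l'' ε t) ε := fun ε t =>
    (hd ε t).hasFDerivAt
  -- The parameter is read as the constant function `ε` on `[a, b]`, so that `ε ↦ l ε ·` is a
  -- superposition operator along a line in `C([a, b], ℝ)`.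
  have hcurve : HasDerivAt (fun ε : ℝ => (τ + ε * d, nemytskii hl
      (ContinuousLinearMap.const ℝ (Icc a b) ε)))
      (d, pointwiseCLM (nemytskii hl'' (ContinuousLinearMap.const ℝ (Icc a b) (0 : ℝ)))
        (ContinuousLinearMap.const ℝ (Icc a b) 1)) 0 := by
    refine HasDerivAt.prodMk ?_ ?_
    · simpa using ((hasDerivAt_id (0 : ℝ)).mul_const d).const_add τ
    · exact (hasStrictFDerivAt_nemytskii hl hl'' hd'' _).hasFDerivAt.comp_hasDerivAt (0 : ℝ)
        (ContinuousLinearMap.const ℝ (Icc a b) (M := ℝ)).hasDerivAt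
  have hmain := (hasStrictFDerivAt_integral_IccExtend hab s τ (nemytskii hl
      (ContinuousLinearMap.const ℝ (Icc a b) (0 : ℝ)))).hasFDerivAt
  have h0 : (τ, nemytskii hl (ContinuousLinearMap.const ℝ (Icc a b) (0 : ℝ))) =
      (τ + 0 * d, nemytskii hl (ContinuousLinearMap.const ℝ (Icc a b) (0 : ℝ))) := by simp
  rw [h0] at hmain
  have hcomp := hmain.comp_hasDerivAt (0 : ℝ) hcurve
  have hsub : ∀ T ∈ Icc a b, uIcc s T ⊆ Icc a b := fun T hT => ordConnected_Icc.uIcc_subset hs hT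
  refine (hcomp.congr_of_eventuallyEq ?_).congr_deriv ?_
  · have hc : Tendsto (fun ε : ℝ => τ + ε * d) (𝓝 0) (𝓝 τ) := by
      have : Continuous fun ε : ℝ => τ + ε * d := by fun_prop
      simpa using this.tendsto 0
    filter_upwards [hc.eventually (Icc_mem_nhds hτ.1 hτ.2)] with ε hε
    refine intervalIntegral.integral_congr fun t ht => ?_
    simp only
    rw [IccExtend_of_mem _ _ (hsub _ hε ht)]
    rfl
  · simp only [add_apply, ContinuousLinearMap.smulRight_apply,
      ContinuousLinearMap.coe_fst', ContinuousLinearMap.comp_apply, ContinuousLinearMap.coe_snd',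
      integralCLM_apply]
    congr 1
    · rw [IccExtend_of_mem _ _ ⟨hτ.1.le, hτ.2.le⟩]; rfl
    · refine intervalIntegral.integral_congr fun t ht => ?_
      rw [IccExtend_of_mem _ _ (hsub _ ⟨hτ.1.le, hτ.2.le⟩ ht)]
      simp [l'']

end Operators

/-! ### First variation of the augmented cost -/

section StateControl

variable {n m : ℕ} {V : Type*} [NormedAddCommGroup V] [NormedSpace ℝ V]

/-- Derivative with respect to state and control. -/
noncomputable def stateControlDeriv
    (F : EuclideanSpace ℝ (Fin n) → EuclideanSpace ℝ (Fin m) → ℝ → V)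
    (z : EuclideanSpace ℝ (Fin n) × EuclideanSpace ℝ (Fin m)) (t : ℝ) :
    EuclideanSpace ℝ (Fin n) × EuclideanSpace ℝ (Fin m) →L[ℝ] V :=
  fderiv ℝ (fun z : EuclideanSpace ℝ (Fin n) × EuclideanSpace ℝ (Fin m) => F z.1 z.2 t) z

namespace IsC1InStateControl

variable {F : EuclideanSpace ℝ (Fin n) → EuclideanSpace ℝ (Fin m) → ℝ → V}

theorem continuous_comp (hF : IsC1InStateControl F) {X : Type*} [TopologicalSpace X]
    {x : X → EuclideanSpace ℝ (Fin n)} {u : X → EuclideanSpace ℝ (Fin m)} {t : X → ℝ}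
    (hx : Continuous x) (hu : Continuous u) (ht : Continuous t) :
    Continuous fun r => F (x r) (u r) (t r) :=
  hF.1.comp ((hx.prodMk hu).prodMk ht)

theorem continuous_deriv_comp (hF : IsC1InStateControl F) {X : Type*} [TopologicalSpace X]
    {x : X → EuclideanSpace ℝ (Fin n)} {u : X → EuclideanSpace ℝ (Fin m)} {t : X → ℝ}
    (hx : Continuous x) (hu : Continuous u) (ht : Continuous t) :
    Continuous fun r => stateControlDeriv F (x r, u r) (t r) :=
  hF.2.2.comp ((hx.prodMk hu).prodMk ht)

theorem hasFDerivAt (hF : IsC1InStateControl F)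
    (z : EuclideanSpace ℝ (Fin n) × EuclideanSpace ℝ (Fin m)) (t : ℝ) :
    HasFDerivAt (fun z : EuclideanSpace ℝ (Fin n) × EuclideanSpace ℝ (Fin m) => F z.1 z.2 t)
      (stateControlDeriv F z t) z :=
  (hF.2.1 t z).hasFDerivAt

theorem hasFDerivAt_state (hF : IsC1InStateControl F) (x : EuclideanSpace ℝ (Fin n))
    (u : EuclideanSpace ℝ (Fin m)) (t : ℝ) :
    HasFDerivAt (fun x => F x u t)
      ((stateControlDeriv F (x, u) t).comp (ContinuousLinearMap.inl ℝ _ _)) x :=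
  HasFDerivAt.comp (f := fun x => (x, u)) x (hF.hasFDerivAt (x, u) t)
    (hasFDerivAt_prodMk_left x u)

theorem hasDerivAt_line (hF : IsC1InStateControl F) (x δx : EuclideanSpace ℝ (Fin n))
    (u δu : EuclideanSpace ℝ (Fin m)) (t ε : ℝ) :
    HasDerivAt (fun ε : ℝ => F (x + ε • δx) (u + ε • δu) t)
      (stateControlDeriv F (x + ε • δx, u + ε • δu) t (δx, δu)) ε := by
  have h1 : HasDerivAt (fun ε : ℝ => (x + ε • δx, u + ε • δu)) (δx, δu) ε := by
    refine HasDerivAt.prodMk ?_ ?_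
    · simpa using ((hasDerivAt_id ε).smul_const δx).const_add x
    · simpa using ((hasDerivAt_id ε).smul_const δu).const_add u
  exact (hF.hasFDerivAt (x + ε • δx, u + ε • δu) t).comp_hasDerivAt ε h1

end IsC1InStateControl

end StateControl

section FirstVariation

open Set MeasureTheory

variable {n m : ℕ} {F : EuclideanSpace ℝ (Fin n) → EuclideanSpace ℝ (Fin m) → ℝ →
    EuclideanSpace ℝ (Fin n)} {L : EuclideanSpace ℝ (Fin n) → EuclideanSpace ℝ (Fin m) → ℝ → ℝ}

/-- Integrand of the first variation of one phase of the augmented cost. -/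
noncomputable def phaseVariation (F : EuclideanSpace ℝ (Fin n) → EuclideanSpace ℝ (Fin m) → ℝ →
    EuclideanSpace ℝ (Fin n)) (L : EuclideanSpace ℝ (Fin n) → EuclideanSpace ℝ (Fin m) → ℝ → ℝ)
    (x : ℝ → EuclideanSpace ℝ (Fin n)) (u : ℝ → EuclideanSpace ℝ (Fin m)) (a : ℝ)
    (lam δx : ℝ → EuclideanSpace ℝ (Fin n)) (δu : ℝ → EuclideanSpace ℝ (Fin m)) (t : ℝ) : ℝ :=
  a * stateControlDeriv L (x t, u t) t (δx t, δu t) +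
    ⟪lam t, stateControlDeriv F (x t, u t) t (δx t, δu t) - deriv δx t⟫_ℝ

variable {x δx lam : ℝ → EuclideanSpace ℝ (Fin n)} {u δu : ℝ → EuclideanSpace ℝ (Fin m)}

theorem continuous_phaseVariation (hF : IsC1InStateControl F) (hL : IsC1InStateControl L)
    (hx : Continuous x) (hu : Continuous u) (hδx : ContDiff ℝ 1 δx) (hδu : Continuous δu)
    (hlam : Continuous lam) (a : ℝ) : Continuous (phaseVariation F L x u a lam δx δu) := by
  have h1 := hδx.continuous
  refine (continuous_const.mul ?_).add (hlam.inner (Continuous.sub ?_ ?_))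
  · exact (hL.continuous_deriv_comp hx hu continuous_id).clm_apply (h1.prodMk hδu)
  · exact (hF.continuous_deriv_comp hx hu continuous_id).clm_apply (h1.prodMk hδu)
  · exact hδx.continuous_deriv le_rfl

/-- The order of `s` and `τ` is left free, because the second phase is treated as minus the integral
from `tf` back to the switch. -/
theorem hasDerivAt_phase_augmentedCost (hF : IsC1InStateControl F) (hL : IsC1InStateControl L)
    (hx : ContDiff ℝ 1 x) (hu : Continuous u) (hδx : ContDiff ℝ 1 δx) (hδu : Continuous δu)
    (hlam : Continuous lam) (a s τ d : ℝ) :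
    HasDerivAt (fun ε : ℝ => ∫ t in s..τ + ε * d,
        (a * L (x t + ε • δx t) (u t + ε • δu t) t +
          ⟪lam t, F (x t + ε • δx t) (u t + ε • δu t) t - deriv (fun r => x r + ε • δx r) t⟫_ℝ))
      (d * (a * L (x τ) (u τ) τ + ⟪lam τ, F (x τ) (u τ) τ - deriv x τ⟫_ℝ) +
        ∫ t in s..τ, phaseVariation F L x u a lam δx δu t) 0 := by
  have hxd : ∀ t, DifferentiableAt ℝ x t := fun t => hx.differentiable one_ne_zero t
  have hδd : ∀ t, DifferentiableAt ℝ δx t := fun t => hδx.differentiable one_ne_zero t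
  have hder : ∀ (ε t : ℝ), deriv (fun r => x r + ε • δx r) t = deriv x t + ε • deriv δx t :=
    fun ε t => ((hxd t).hasDerivAt.add ((hδd t).hasDerivAt.const_smul ε)).deriv
  simp only [hder]
  have hxc := hx.continuous
  have hδc := hδx.continuous
  have hx' : Continuous (deriv x) := hx.continuous_deriv le_rfl
  have hδ' : Continuous (deriv δx) := hδx.continuous_deriv le_rfl
  have c1 : Continuous fun q : ℝ × ℝ => x q.2 + q.1 • δx q.2 := by fun_prop
  have c2 : Continuous fun q : ℝ × ℝ => u q.2 + q.1 • δu q.2 := by fun_prop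
  have c3 : Continuous fun q : ℝ × ℝ => (δx q.2, δu q.2) := by fun_prop
  have := hasDerivAt_integral_of_param
    (l := fun ε t => a * L (x t + ε • δx t) (u t + ε • δu t) t +
      ⟪lam t, F (x t + ε • δx t) (u t + ε • δu t) t - (deriv x t + ε • deriv δx t)⟫_ℝ)
    (l' := fun ε t => a * stateControlDeriv L (x t + ε • δx t, u t + ε • δu t) t (δx t, δu t) +
      ⟪lam t, stateControlDeriv F (x t + ε • δx t, u t + ε • δu t) t (δx t, δu t) -
        deriv δx t⟫_ℝ)
    ((continuous_const.mul (hL.continuous_comp c1 c2 continuous_snd)).add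
      (Continuous.inner (by fun_prop) ((hF.continuous_comp c1 c2 continuous_snd).sub
        (by fun_prop))))
    ((continuous_const.mul ((hL.continuous_deriv_comp c1 c2 continuous_snd).clm_apply c3)).add
      (Continuous.inner (by fun_prop) (((hF.continuous_deriv_comp c1 c2
        continuous_snd).clm_apply c3).sub (by fun_prop))))
    (fun ε t => ?_) s τ d
  · simpa [phaseVariation] using this
  · refine ((hL.hasDerivAt_line _ _ _ _ t ε).const_mul a).add ?_
    have h2 : HasDerivAt (fun ε : ℝ => deriv x t + ε • deriv δx t) (deriv δx t) ε := by
      simpa using ((hasDerivAt_id ε).smul_const (deriv δx t)).const_add (deriv x t)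
    simpa using (hasDerivAt_const ε (lam t)).inner ℝ ((hF.hasDerivAt_line _ _ _ _ t ε).sub h2)

/-- Integration by parts along a solution of the adjoint equation. -/
theorem integral_phaseVariation_of_adjoint (hF : IsC1InStateControl F)
    (hL : IsC1InStateControl L) (hx : Continuous x) (hu : Continuous u) (hδx : ContDiff ℝ 1 δx)
    (hlam : Continuous lam) {lam' : ℝ → EuclideanSpace ℝ (Fin n)} {a s τ : ℝ} (hsτ : s ≤ τ)
    (hd : ∀ t ∈ Ioo s τ, HasDerivAt lam (lam' t) t)
    (hadj : ∀ t ∈ Ioo s τ, ∀ v, ⟪lam' t, v⟫_ℝ =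
      -(a * stateControlDeriv L (x t, u t) t (v, 0) +
        ⟪lam t, stateControlDeriv F (x t, u t) t (v, 0)⟫_ℝ)) :
    ∫ t in s..τ, phaseVariation F L x u a lam δx (fun _ => 0) t =
      ⟪lam s, δx s⟫_ℝ - ⟪lam τ, δx τ⟫_ℝ := by
  have hδc := hδx.continuous
  rw [intervalIntegral.integral_eq_sub_of_hasDerivAt_of_le
    (f := fun t => -⟪lam t, δx t⟫_ℝ) hsτ (by fun_prop) (fun t ht => ?_)
    ((continuous_phaseVariation hF hL hx hu hδx continuous_const hlam a).intervalIntegrable _ _)]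
  · ring
  · have := ((hd t ht).inner ℝ (hδx.differentiable one_ne_zero t).hasDerivAt).neg
    refine this.congr_deriv ?_
    rw [hadj t ht, phaseVariation, inner_sub_right]
    ring

theorem inner_gradient_hamiltonian (hF : IsC1InStateControl F) (hL : IsC1InStateControl L)
    (x l v : EuclideanSpace ℝ (Fin n)) (u : EuclideanSpace ℝ (Fin m)) (t : ℝ) :
    ⟪∇ (fun x => L x u t + ⟪l, F x u t⟫_ℝ) x, v⟫_ℝ =
      stateControlDeriv L (x, u) t (v, 0) + ⟪l, stateControlDeriv F (x, u) t (v, 0)⟫_ℝ := by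
  have h : HasFDerivAt (fun x => L x u t + ⟪l, F x u t⟫_ℝ) _ x := (hL.hasFDerivAt_state x u t).add
    ((hasFDerivAt_const l x).inner ℝ (hF.hasFDerivAt_state x u t))
  rw [gradient, InnerProductSpace.toDual_symm_apply, h.fderiv]
  simp

namespace SwitchedProblem

/-- First variation of the augmented cost. -/
noncomputable def firstVariation (P : SwitchedProblem n m) (p : SwitchedProcess n m) (a : ℝ)
    (lam₁ lam₂ : ℝ → EuclideanSpace ℝ (Fin n)) (ν : ℝ) (κ : EuclideanSpace ℝ (Fin n))
    (δ : SwitchedProcess n m) : ℝ :=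
  a * fderiv ℝ P.φ (p.x₂ P.tf) (δ.x₂ P.tf) +
    ν * ⟪P.normal p, δ.τ • P.f₁At p + δ.x₁ p.τ⟫_ℝ +
    ⟪κ, δ.τ • (P.f₂At p - P.f₁At p) + (δ.x₂ p.τ - δ.x₁ p.τ)⟫_ℝ - δ.τ * (a * P.jumpL p) +
    (∫ t in P.t₀..p.τ, phaseVariation P.f₁ P.L₁ p.x₁ p.u₁ a lam₁ δ.x₁ δ.u₁ t) +
    ∫ t in p.τ..P.tf, phaseVariation P.f₂ P.L₂ p.x₂ p.u₂ a lam₂ δ.x₂ δ.u₂ t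

variable {P : SwitchedProblem n m} {p : SwitchedProcess n m}
  {lam₁ lam₂ : ℝ → EuclideanSpace ℝ (Fin n)}

theorem Admissible.f₁At_eq (hp : P.Admissible p) : deriv p.x₁ p.τ = P.f₁At p :=
  (hp.dyn₁ p.τ ⟨hp.t₀_lt.le, le_rfl⟩).deriv

theorem Admissible.f₂At_eq (hp : P.Admissible p) : deriv p.x₂ p.τ = P.f₂At p :=
  (hp.dyn₂ p.τ ⟨le_rfl, hp.lt_tf.le⟩).deriv

theorem inner_normal (v : EuclideanSpace ℝ (Fin n)) :
    ⟪P.normal p, v⟫_ℝ = fderiv ℝ P.g (p.x₁ p.τ) v := by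
  rw [normal, gradient, InnerProductSpace.toDual_symm_apply]

/-- A curve evaluated at a moving time. -/
theorem hasDerivAt_vary_apply {x δx : ℝ → EuclideanSpace ℝ (Fin n)} (hx : ContDiff ℝ 1 x)
    (hδx : ContDiff ℝ 1 δx) (τ d : ℝ) :
    HasDerivAt (fun ε : ℝ => x (τ + ε * d) + ε • δx (τ + ε * d)) (d • deriv x τ + δx τ) 0 := by
  have h1 : HasDerivAt (fun ε : ℝ => τ + ε * d) d 0 := by
    simpa using ((hasDerivAt_id (0 : ℝ)).mul_const d).const_add τ
  have hx1 : HasDerivAt x (deriv x τ) (τ + 0 * d) := by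
    simpa using (hx.differentiable one_ne_zero τ).hasDerivAt
  have hx2 := (hδx.differentiable one_ne_zero (τ + 0 * d)).hasDerivAt
  have := (hx1.scomp (0 : ℝ) h1).add ((hasDerivAt_id (0 : ℝ)).smul (hx2.scomp (0 : ℝ) h1))
  refine this.congr_deriv ?_
  simp

theorem Admissible.hasDerivAt_augmentedCost (hP : P.Regular) (hp : P.Admissible p)
    (h₁ : Continuous lam₁) (h₂ : Continuous lam₂) (a ν : ℝ) (κ : EuclideanSpace ℝ (Fin n))
    {δ : SwitchedProcess n m} (hδ : P.IsVariation δ) :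
    HasDerivAt (fun ε : ℝ => P.augmentedCost a lam₁ lam₂ ν κ (vary p δ ε))
      (P.firstVariation p a lam₁ lam₂ ν κ δ) 0 := by
  have i1 := hasDerivAt_phase_augmentedCost hP.f₁ hP.L₁ hp.x₁_C1 hp.u₁_cont hδ.x₁_C1 hδ.u₁_cont
    h₁ a P.t₀ p.τ δ.τ
  have i2 := (hasDerivAt_phase_augmentedCost hP.f₂ hP.L₂ hp.x₂_C1 hp.u₂_cont hδ.x₂_C1 hδ.u₂_cont
    h₂ a P.tf p.τ δ.τ).neg
  have y1 := hasDerivAt_vary_apply hp.x₁_C1 hδ.x₁_C1 p.τ δ.τ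
  have y2 := hasDerivAt_vary_apply hp.x₂_C1 hδ.x₂_C1 p.τ δ.τ
  have y3 : HasDerivAt (fun ε : ℝ => p.x₂ P.tf + ε • δ.x₂ P.tf) (δ.x₂ P.tf) 0 := by
    simpa using ((hasDerivAt_id (0 : ℝ)).smul_const (δ.x₂ P.tf)).const_add (p.x₂ P.tf)
  have g1 : HasFDerivAt P.g (fderiv ℝ P.g (p.x₁ p.τ))
      (p.x₁ (p.τ + 0 * δ.τ) + (0 : ℝ) • δ.x₁ (p.τ + 0 * δ.τ)) := by
    simpa using (hP.g.differentiable one_ne_zero (p.x₁ p.τ)).hasFDerivAt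
  have φ1 : HasFDerivAt P.φ (fderiv ℝ P.φ (p.x₂ P.tf)) (p.x₂ P.tf + (0 : ℝ) • δ.x₂ P.tf) := by
    simpa using (hP.φ.differentiable one_ne_zero (p.x₂ P.tf)).hasFDerivAt
  have := (((((φ1.comp_hasDerivAt (0 : ℝ) y3).const_mul a).add
    ((g1.comp_hasDerivAt (0 : ℝ) y1).const_mul ν)).add
      ((hasDerivAt_const (0 : ℝ) κ).inner ℝ (y2.sub y1))).add i1).add i2
  refine (this.congr_of_eventuallyEq (Filter.Eventually.of_forall fun ε => ?_)).congr_deriv ?_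
  · simp only [augmentedCost, vary, Pi.add_apply, Pi.neg_apply, Function.comp_apply, Pi.sub_apply]
    rw [intervalIntegral.integral_symm P.tf]
  -- At the switch `ẋᵢ = fᵢ`, so the multiplier terms drop out of the integrands there and the
  -- moving limit contributes only `δτ · a (L₁ - L₂)`.
  · rw [firstVariation, hp.f₁At_eq, hp.f₂At_eq, inner_normal, jumpL,
      intervalIntegral.integral_symm P.tf p.τ]
    simp only [f₁At, f₂At, sub_self, inner_zero_right, inner_zero_left, add_zero]
    rw [show ∀ (v w a b : EuclideanSpace ℝ (Fin n)), δ.τ • v + a - (δ.τ • w + b) =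
      δ.τ • (v - w) + (a - b) from fun v w a b => by rw [smul_sub]; abel]
    ring

theorem Admissible.isStationary_iff (hP : P.Regular) (hp : P.Admissible p)
    (h₁ : Continuous lam₁) (h₂ : Continuous lam₂) {a ν : ℝ} {κ : EuclideanSpace ℝ (Fin n)} :
    P.IsStationary p a lam₁ lam₂ ν κ ↔
      ∀ δ, P.IsVariation δ → P.firstVariation p a lam₁ lam₂ ν κ δ = 0 := by
  refine forall₂_congr fun δ hδ => ?_
  have := hp.hasDerivAt_augmentedCost hP h₁ h₂ a ν κ hδ
  exact ⟨fun h => this.unique h, fun h => h ▸ this⟩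

/-- The jump law. -/
theorem IsCostate.jump_eq (hP : P.Regular) (hp : P.Admissible p) (hc : P.IsCostate p lam₁ lam₂)
    (hne : ⟪P.normal p, P.avgf p⟫_ℝ ≠ 0) :
    lam₂ p.τ - lam₁ p.τ =
      (-(P.jumpL p + ⟪(1 / 2 : ℝ) • (lam₂ p.τ + lam₁ p.τ), P.jumpf p⟫_ℝ) /
        ⟪P.normal p, P.avgf p⟫_ℝ) • P.normal p := by
  obtain ⟨ν, κ, hs⟩ := hc.stationary
  rw [hp.isStationary_iff hP hc.cont₁ hc.cont₂] at hs
  have z0 : ContDiff ℝ 1 fun _ : ℝ => (0 : EuclideanSpace ℝ (Fin n)) := contDiff_const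
  have hzero : ∀ (F : EuclideanSpace ℝ (Fin n) → EuclideanSpace ℝ (Fin m) → ℝ →
      EuclideanSpace ℝ (Fin n)) (L : EuclideanSpace ℝ (Fin n) → EuclideanSpace ℝ (Fin m) → ℝ → ℝ)
      (x lam : ℝ → EuclideanSpace ℝ (Fin n)) (u : ℝ → EuclideanSpace ℝ (Fin m)) (t : ℝ),
      phaseVariation F L x u 1 lam (fun _ => 0) (fun _ => 0) t = 0 := fun F L x lam u t => by
    have : ((0 : EuclideanSpace ℝ (Fin n)), (0 : EuclideanSpace ℝ (Fin m))) = 0 := rfl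
    simp [phaseVariation, this]
  -- Moving the switching time alone: `ν mᵀf₁ + κᵀΔf - ΔL = 0`.
  have e0 := hs ⟨1, fun _ => 0, fun _ => 0, fun _ => 0, fun _ => 0⟩
    ⟨continuous_const, continuous_const, z0, z0, rfl, fun _ => rfl⟩
  simp only [firstVariation, hzero] at e0
  simp only [map_zero, mul_zero, one_smul, add_zero, sub_self, zero_add,
    intervalIntegral.integral_zero, one_mul] at e0
  -- A linear ramp from `0` at `t₀` to an arbitrary `c` at `τ`; after integration by parts only its
  -- value at `τ` survives.
  have e1 : ν • P.normal p - κ = lam₁ p.τ := by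
    refine ext_inner_right ℝ fun c => ?_
    have hC : ContDiff ℝ 1 fun t : ℝ => ((t - P.t₀) / (p.τ - P.t₀)) • c := by fun_prop
    have := hs ⟨0, fun t => ((t - P.t₀) / (p.τ - P.t₀)) • c, fun _ => 0, fun _ => 0, fun _ => 0⟩
      ⟨continuous_const, continuous_const, hC, z0, by simp, fun _ => rfl⟩
    simp only [firstVariation, hzero] at this
    rw [integral_phaseVariation_of_adjoint hP.f₁ hP.L₁ hp.x₁_C1.continuous hp.u₁_cont hC hc.cont₁
      hp.t₀_lt.le hc.adjoint₁ fun t _ v => by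
        rw [inner_neg_left, one_mul]
        exact congrArg Neg.neg (inner_gradient_hamiltonian hP.f₁ hP.L₁ _ _ v _ t)] at this
    rw [div_self (sub_pos.2 hp.t₀_lt).ne'] at this
    simp only [map_zero, mul_zero, one_smul, zero_smul, zero_add, zero_sub, sub_self, zero_div,
      zero_mul, inner_neg_right, inner_zero_right, sub_zero, intervalIntegral.integral_zero,
      add_zero] at this
    rw [inner_sub_left, real_inner_smul_left]
    linarith
  -- This ramp vanishes at `tf`, so it is allowed for a prescribed as well as a free final state,
  -- and the terminal cost does not enter.
  have e2 : -κ = lam₂ p.τ := by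
    refine ext_inner_right ℝ fun c => ?_
    have hC : ContDiff ℝ 1 fun t : ℝ => ((P.tf - t) / (P.tf - p.τ)) • c := by fun_prop
    have := hs ⟨0, fun _ => 0, fun t => ((P.tf - t) / (P.tf - p.τ)) • c, fun _ => 0, fun _ => 0⟩
      ⟨continuous_const, continuous_const, z0, hC, rfl, by simp⟩
    simp only [firstVariation, hzero] at this
    rw [integral_phaseVariation_of_adjoint hP.f₂ hP.L₂ hp.x₂_C1.continuous hp.u₂_cont hC hc.cont₂
      hp.lt_tf.le hc.adjoint₂ fun t _ v => by
        rw [inner_neg_left, one_mul]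
        exact congrArg Neg.neg (inner_gradient_hamiltonian hP.f₂ hP.L₂ _ _ v _ t)] at this
    rw [div_self (sub_pos.2 hp.lt_tf).ne'] at this
    simp only [map_zero, mul_zero, one_smul, zero_smul, zero_add, sub_self, zero_div,
      zero_mul, inner_zero_right, sub_zero, intervalIntegral.integral_zero,
      add_zero] at this
    rw [inner_neg_left]
    linarith
  have hjump : lam₂ p.τ - lam₁ p.τ = (-ν) • P.normal p := by
    rw [← e1, ← e2, neg_smul]; abel
  rw [hjump]
  congr 1
  rw [eq_div_iff hne]
  have hκ : κ = -lam₂ p.τ := by rw [← e2, neg_neg]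
  -- With this sum, `e0` becomes `ν mᵀ⟨f⟩ = ΔL + ⟨λ⟩ᵀΔf`, since `mᵀf₁ + mᵀΔf / 2 = mᵀ⟨f⟩`.
  have hl : lam₂ p.τ + lam₁ p.τ = ν • P.normal p - (2 : ℝ) • κ := by
    rw [← e1, ← e2, two_smul]; abel
  rw [hl]
  simp only [avgf, jumpf, inner_sub_left, inner_sub_right, inner_add_right, real_inner_smul_left,
    real_inner_smul_right] at e0 ⊢
  linarith

end SwitchedProblem

end FirstVariation

/-! ### The Banach space of one phase -/

section Phase

open Set Filter
open scoped Topology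

variable {E U V : Type*} [NormedAddCommGroup E] [NormedSpace ℝ E]
  [NormedAddCommGroup U] [NormedSpace ℝ U] [NormedAddCommGroup V] [NormedSpace ℝ V]
  {S : Submodule ℝ E} {a b : ℝ} (hab : a ≤ b) (s : ℝ) (c : E)

/-- Coordinates of one phase: offset of the state at the base time, velocity, and control. -/
abbrev PhaseSpace (S : Submodule ℝ E) (U : Type*) [NormedAddCommGroup U] [NormedSpace ℝ U]
    (a b : ℝ) : Type _ :=
  S × C(Icc a b, E) × C(Icc a b, U)

/-- State at time `t`, the state at the base time `s` being `c + q.1`. -/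
noncomputable def phaseState (q : PhaseSpace S U a b) (t : ℝ) : E :=
  c + q.1 + ∫ r in s..t, IccExtend hab q.2.1 r

@[simp]
theorem phaseState_self (q : PhaseSpace S U a b) : phaseState hab s c q s = c + q.1 := by
  simp [phaseState]

variable [CompleteSpace E]

theorem hasDerivAt_phaseState (q : PhaseSpace S U a b) (t : ℝ) :
    HasDerivAt (phaseState hab s c q) (IccExtend hab q.2.1 t) t :=
  (hasDerivAt_integral_iccExtend hab s t q.2.1).const_add _

theorem contDiff_phaseState (q : PhaseSpace S U a b) : ContDiff ℝ 1 (phaseState hab s c q) := by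
  refine contDiff_one_iff_deriv.2
    ⟨fun t => (hasDerivAt_phaseState hab s c q t).differentiableAt, ?_⟩
  rw [funext fun t => (hasDerivAt_phaseState hab s c q t).deriv]
  exact continuous_iccExtend hab _

/-- This is the reason for taking the velocity as coordinate: a primitive is strictly differentiable
jointly in the evaluation time and the integrand, whereas evaluating a merely continuous function at
a moving time is not differentiable. -/
theorem hasStrictFDerivAt_phaseState (τ : ℝ) (q : PhaseSpace S U a b) :
    ∃ D : ℝ × PhaseSpace S U a b →L[ℝ] E,
      (∀ d y, D (d, y) = d • IccExtend hab q.2.1 τ + phaseState hab s 0 y τ) ∧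
      HasStrictFDerivAt (fun z : ℝ × PhaseSpace S U a b => phaseState hab s c z.2 z.1) D (τ, q) := by
  let pr : ℝ × PhaseSpace S U a b →L[ℝ] ℝ × C(Icc a b, E) :=
    (ContinuousLinearMap.fst ℝ _ _).prod ((ContinuousLinearMap.fst ℝ _ _).comp
      ((ContinuousLinearMap.snd ℝ _ _).comp (ContinuousLinearMap.snd ℝ _ _)))
  let off : ℝ × PhaseSpace S U a b →L[ℝ] E :=
    S.subtypeL.comp ((ContinuousLinearMap.fst ℝ _ _).comp (ContinuousLinearMap.snd ℝ _ _))
  have h1 := (hasStrictFDerivAt_integral_IccExtend hab s τ q.2.1).comp (τ, q)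
    (pr.hasStrictFDerivAt (x := (τ, q)))
  have h2 := (off.hasStrictFDerivAt (x := (τ, q))).const_add c
  refine ⟨_, fun d y => ?_, h2.add h1⟩
  simp only [phaseState, add_apply, ContinuousLinearMap.comp_apply, pr, off,
    ContinuousLinearMap.smulRight_apply, zero_add]
  change (y.1 : E) + (d • _ + _) = _
  simp only [ContinuousLinearMap.prod_apply, ContinuousLinearMap.coe_snd', integralCLM_apply]
  change (y.1 : E) + (d • _ + ∫ t in s..τ, IccExtend hab y.2.1 t) = _
  abel

theorem continuous_phaseState_uncurry :
    Continuous fun z : ℝ × PhaseSpace S U a b => phaseState hab s c z.2 z.1 :=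
  continuous_iff_continuousAt.2 fun z => by
    obtain ⟨D, -, hD⟩ := hasStrictFDerivAt_phaseState hab s c z.1 z.2
    exact hD.continuousAt

/-- State and control as a continuous linear function of the phase coordinates. -/
noncomputable def phasePairCLM : PhaseSpace S U a b →L[ℝ] C(Icc a b, E × U) :=
  ((ContinuousLinearMap.inl ℝ E U).compLeftContinuous ℝ (Icc a b)).comp
    ((ContinuousLinearMap.const ℝ (Icc a b)).comp
      (S.subtypeL.comp (ContinuousLinearMap.fst ℝ _ _)) +
      (primitiveCLM hab s).comp
        ((ContinuousLinearMap.fst ℝ _ _).comp (ContinuousLinearMap.snd ℝ _ _))) +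
  ((ContinuousLinearMap.inr ℝ E U).compLeftContinuous ℝ (Icc a b)).comp
    ((ContinuousLinearMap.snd ℝ _ _).comp (ContinuousLinearMap.snd ℝ _ _))

theorem phasePairCLM_apply (q : PhaseSpace S U a b) (t : Icc a b) :
    phasePairCLM hab s q t = (phaseState hab s 0 q t, q.2.2 t) := by
  ext <;> simp [phasePairCLM, phaseState]

/-- State and control along the phase. -/
noncomputable def phasePair (q : PhaseSpace S U a b) : C(Icc a b, E × U) :=
  ContinuousMap.const _ (c, 0) + phasePairCLM hab s q

theorem phasePair_apply (q : PhaseSpace S U a b) (t : Icc a b) :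
    phasePair hab s c q t = (phaseState hab s c q t, q.2.2 t) := by
  rw [phasePair, ContinuousMap.add_apply, phasePairCLM_apply]
  simp [phaseState, add_assoc]

theorem hasStrictFDerivAt_phasePair (q : PhaseSpace S U a b) :
    HasStrictFDerivAt (fun q : PhaseSpace S U a b => phasePair hab s c q) (phasePairCLM hab s)
      q := by
  have h := (phasePairCLM (S := S) (U := U) hab s).hasStrictFDerivAt (x := q)
  exact h.const_add (ContinuousMap.const _ (c, 0))

variable {F : E × U → ℝ → V} {F' : E × U → ℝ → E × U →L[ℝ] V}

theorem hasStrictFDerivAt_nemytskii_phasePair (hF : Continuous fun q : (E × U) × ℝ => F q.1 q.2)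
    (hF' : Continuous fun q : (E × U) × ℝ => F' q.1 q.2)
    (hd : ∀ z t, HasFDerivAt (fun z => F z t) (F' z t) z) (q : PhaseSpace S U a b) :
    HasStrictFDerivAt (fun q : PhaseSpace S U a b => nemytskii hF (phasePair hab s c q))
      ((pointwiseCLM (nemytskii hF' (phasePair hab s c q))).comp (phasePairCLM hab s)) q := by
  have h1 := hasStrictFDerivAt_phasePair (S := S) (U := U) hab s c q
  have h2 := hasStrictFDerivAt_nemytskii hF hF' hd (phasePair hab s c q)
  exact h2.comp q h1

theorem hasStrictFDerivAt_phase_integral [CompleteSpace V]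
    (hF : Continuous fun q : (E × U) × ℝ => F q.1 q.2)
    (hF' : Continuous fun q : (E × U) × ℝ => F' q.1 q.2)
    (hd : ∀ z t, HasFDerivAt (fun z => F z t) (F' z t) z) (τ : ℝ) (q : PhaseSpace S U a b) :
    ∃ D : ℝ × PhaseSpace S U a b →L[ℝ] V,
      (∀ d y, D (d, y) = d • IccExtend hab (nemytskii hF (phasePair hab s c q)) τ +
        ∫ t in s..τ, IccExtend hab
          (pointwiseCLM (nemytskii hF' (phasePair hab s c q)) (phasePairCLM hab s y)) t) ∧
      HasStrictFDerivAt (fun z : ℝ × PhaseSpace S U a b =>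
        ∫ t in s..z.1, IccExtend hab (nemytskii hF (phasePair hab s c z.2)) t) D (τ, q) := by
  have h1 := (hasStrictFDerivAt_nemytskii_phasePair hab s c hF hF' hd q).comp (τ, q)
    (hasStrictFDerivAt_snd (𝕜 := ℝ) (p := (τ, q)))
  have h2 := (hasStrictFDerivAt_integral_IccExtend hab s τ
    (nemytskii hF (phasePair hab s c q))).comp (τ, q)
    ((hasStrictFDerivAt_fst (𝕜 := ℝ) (p := (τ, q))).prodMk h1)
  exact ⟨_, fun d y => rfl, h2⟩

end Phase

/-! ### Stability of a single transversal crossing under perturbation. -/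

section Crossing

open Set Filter
open scoped Topology

variable {Q : Type*} [TopologicalSpace Q] {q₀ : Q} {τ : ℝ}

/-- Joint continuity keeps the derivative positive on a product of neighbourhoods of `τ` and `q₀`,
so one `ε` serves all nearby `q`. -/
theorem exists_eventually_strictMonoOn {G G' : Q → ℝ → ℝ}
    (hd : ∀ q t, HasDerivAt (G q) (G' q t) t)
    (hG' : Continuous fun z : ℝ × Q => G' z.2 z.1) (hpos : 0 < G' q₀ τ) :
    ∃ ε > 0, ∀ᶠ q in 𝓝 q₀, StrictMonoOn (G q) (Icc (τ - ε) (τ + ε)) := by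
  have h := (hG'.tendsto (τ, q₀)).eventually (lt_mem_nhds hpos)
  rw [nhds_prod_eq, eventually_prod_iff] at h
  obtain ⟨p, hp, r, hr, hpr⟩ := h
  obtain ⟨ε, hε, hεp⟩ := Metric.nhds_basis_closedBall.eventually_iff.1 hp
  refine ⟨ε, hε, hr.mono fun q hq => ?_⟩
  refine strictMonoOn_of_deriv_pos (convex_Icc _ _)
    (fun t _ => (hd q t).continuousAt.continuousWithinAt) fun t ht => ?_
  rw [(hd q t).deriv]
  refine hpr (hεp ?_) hq
  rw [Real.closedBall_eq_Icc]
  exact interior_subset ht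

/-- Away from `τ` the sign persists by compactness of `[c, τ - ε]`; within `ε` of `τ` it follows
from strict monotonicity and the zero at the perturbed crossing time. -/
theorem eventually_neg_before {G : Q → ℝ → ℝ} (hG : Continuous fun z : ℝ × Q => G z.2 z.1)
    {ε c : ℝ} (hε : 0 < ε) (hmono : ∀ᶠ q in 𝓝 q₀, StrictMonoOn (G q) (Icc (τ - ε) (τ + ε)))
    (hneg : ∀ t ∈ Icc c (τ - ε), G q₀ t < 0) :
    ∀ᶠ z : ℝ × Q in 𝓝 (τ, q₀), G z.2 z.1 = 0 → ∀ t ∈ Ico c z.1, G z.2 t < 0 := by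
  have h1 : ∀ᶠ q in 𝓝 q₀, ∀ t ∈ Icc c (τ - ε), G q t < 0 :=
    isCompact_Icc.eventually_forall_of_forall_eventually fun t ht =>
      ((hG.comp continuous_swap).tendsto (q₀, t)).eventually (gt_mem_nhds (hneg t ht))
  have h2 : ∀ᶠ T in 𝓝 τ, T ∈ Icc (τ - ε) (τ + ε) :=
    Icc_mem_nhds (by linarith) (by linarith)
  rw [nhds_prod_eq]
  filter_upwards [h2.prod_mk (hmono.and h1)]
  rintro ⟨T, q⟩ ⟨hT, hm, hq⟩ h0 t ht
  rcases le_total t (τ - ε) with h | h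
  · exact hq t ⟨ht.1, h⟩
  · exact (hm ⟨h, ht.2.le.trans hT.2⟩ hT ht.2).trans_eq h0

theorem eventually_pos_after {G : Q → ℝ → ℝ} (hG : Continuous fun z : ℝ × Q => G z.2 z.1)
    {ε c : ℝ} (hε : 0 < ε) (hmono : ∀ᶠ q in 𝓝 q₀, StrictMonoOn (G q) (Icc (τ - ε) (τ + ε)))
    (hpos : ∀ t ∈ Icc (τ + ε) c, 0 < G q₀ t) :
    ∀ᶠ z : ℝ × Q in 𝓝 (τ, q₀), G z.2 z.1 = 0 → ∀ t ∈ Ioc z.1 c, 0 < G z.2 t := by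
  have h1 : ∀ᶠ q in 𝓝 q₀, ∀ t ∈ Icc (τ + ε) c, 0 < G q t :=
    isCompact_Icc.eventually_forall_of_forall_eventually fun t ht =>
      ((hG.comp continuous_swap).tendsto (q₀, t)).eventually (lt_mem_nhds (hpos t ht))
  have h2 : ∀ᶠ T in 𝓝 τ, T ∈ Icc (τ - ε) (τ + ε) :=
    Icc_mem_nhds (by linarith) (by linarith)
  rw [nhds_prod_eq]
  filter_upwards [h2.prod_mk (hmono.and h1)]
  rintro ⟨T, q⟩ ⟨hT, hm, hq⟩ h0 t ht
  rcases le_total t (τ + ε) with h | h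
  · exact h0.symm.trans_lt (hm hT ⟨hT.1.trans ht.1.le, h⟩ ht.1)
  · exact hq t ⟨h, ht.2⟩

end Crossing

/-! ### Multipliers of an optimal process -/

section Multipliers

open Set Filter
open scoped Topology

variable {n m : ℕ} {V : Type*} [NormedAddCommGroup V] [NormedSpace ℝ V]

/-- The derivative of a vector field along a trajectory, on a compact time interval. -/
noncomputable def IsC1InStateControl.derivAlong
    {F : EuclideanSpace ℝ (Fin n) → EuclideanSpace ℝ (Fin m) → ℝ → V} (hF : IsC1InStateControl F)
    {x : ℝ → EuclideanSpace ℝ (Fin n)} {u : ℝ → EuclideanSpace ℝ (Fin m)} (hx : Continuous x)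
    (hu : Continuous u) (a b : ℝ) :
    C(Icc a b, EuclideanSpace ℝ (Fin n) × EuclideanSpace ℝ (Fin m) →L[ℝ] V) :=
  ⟨fun t => stateControlDeriv F (x t, u t) t,
    (hF.continuous_deriv_comp hx hu continuous_id).comp continuous_subtype_val⟩

/-- Phase coordinates of a trajectory. -/
noncomputable def phaseCoord (S : Submodule ℝ (EuclideanSpace ℝ (Fin n))) (a b : ℝ)
    {x : ℝ → EuclideanSpace ℝ (Fin n)} {u : ℝ → EuclideanSpace ℝ (Fin m)} (hx : ContDiff ℝ 1 x)
    (hu : Continuous u) : PhaseSpace S (EuclideanSpace ℝ (Fin m)) a b :=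
  (0, ⟨fun t => deriv x t, (hx.continuous_deriv le_rfl).comp continuous_subtype_val⟩,
    ⟨fun t => u t, hu.comp continuous_subtype_val⟩)

variable {S : Submodule ℝ (EuclideanSpace ℝ (Fin n))} {a b s t : ℝ} (hab : a ≤ b)
  {x : ℝ → EuclideanSpace ℝ (Fin n)} {u : ℝ → EuclideanSpace ℝ (Fin m)}

theorem phaseState_phaseCoord (hx : ContDiff ℝ 1 x) (hu : Continuous u) (hs : s ∈ Icc a b)
    (ht : t ∈ Icc a b) : phaseState hab s (x s) (phaseCoord S a b hx hu) t = x t := by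
  have h1 : ∫ r in s..t, IccExtend hab (phaseCoord S a b hx hu).2.1 r = ∫ r in s..t, deriv x r :=
    intervalIntegral.integral_congr fun r hr => by
      rw [IccExtend_of_mem _ _ (ordConnected_Icc.uIcc_subset hs ht hr)]
      rfl
  rw [phaseState, h1, intervalIntegral.integral_deriv_eq_sub' x rfl
    (fun r _ => hx.differentiable one_ne_zero r) (hx.continuous_deriv le_rfl).continuousOn]
  simp [phaseCoord]

theorem phasePair_phaseCoord (hx : ContDiff ℝ 1 x) (hu : Continuous u) (hs : s ∈ Icc a b)
    (t : Icc a b) : phasePair hab s (x s) (phaseCoord S a b hx hu) t = (x t, u t) := by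
  rw [phasePair_apply, phaseState_phaseCoord hab hx hu hs t.2]
  rfl

theorem iccExtend_phaseCoord (hx : ContDiff ℝ 1 x) (hu : Continuous u) (ht : t ∈ Icc a b) :
    IccExtend hab (phaseCoord S a b hx hu).2.1 t = deriv x t := by
  rw [IccExtend_of_mem _ _ ht]
  rfl

/-- The velocity minus the vector field along a phase is strictly differentiable. -/
theorem hasStrictFDerivAt_defect {F : EuclideanSpace ℝ (Fin n) → EuclideanSpace ℝ (Fin m) → ℝ →
      EuclideanSpace ℝ (Fin n)} (hF : IsC1InStateControl F) (hx : ContDiff ℝ 1 x)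
    (hu : Continuous u) (hs : s ∈ Icc a b) :
    ∃ D : PhaseSpace S (EuclideanSpace ℝ (Fin m)) a b →L[ℝ] C(Icc a b, EuclideanSpace ℝ (Fin n)),
      (∀ y, D y = y.2.1 - pointwiseCLM (hF.derivAlong hx.continuous hu a b)
        (phasePairCLM hab s y)) ∧
      HasStrictFDerivAt (fun q : PhaseSpace S (EuclideanSpace ℝ (Fin m)) a b => q.2.1 -
        nemytskii (F := fun z t => F z.1 z.2 t) hF.1 (phasePair hab s (x s) q)) D
        (phaseCoord S a b hx hu) := by
  have h1 := hasStrictFDerivAt_nemytskii_phasePair (S := S) hab s (x s)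
    (F := fun z t => F z.1 z.2 t) hF.1 hF.2.2 hF.hasFDerivAt (phaseCoord S a b hx hu)
  have h2 := (((ContinuousLinearMap.fst ℝ _ _).comp (ContinuousLinearMap.snd ℝ _ _) :
    PhaseSpace S (EuclideanSpace ℝ (Fin m)) a b →L[ℝ]
      C(Icc a b, EuclideanSpace ℝ (Fin n)))).hasStrictFDerivAt (x := phaseCoord S a b hx hu)
  refine ⟨_, fun y => ?_, h2.sub h1⟩
  change y.2.1 - _ = _
  congr 1
  ext1 t
  change stateControlDeriv F (phasePair hab s (x s) (phaseCoord S a b hx hu) t) t _ = _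
  rw [phasePair_phaseCoord hab hx hu hs]
  rfl

/-- The running cost of a phase is strictly differentiable. -/
theorem hasStrictFDerivAt_runningCost
    {L : EuclideanSpace ℝ (Fin n) → EuclideanSpace ℝ (Fin m) → ℝ → ℝ}
    (hL : IsC1InStateControl L) (hx : ContDiff ℝ 1 x) (hu : Continuous u) (hs : s ∈ Icc a b)
    {τ : ℝ} (hτ : τ ∈ Icc a b) :
    ∃ D : ℝ × PhaseSpace S (EuclideanSpace ℝ (Fin m)) a b →L[ℝ] ℝ,
      (∀ d y, D (d, y) = d * L (x τ) (u τ) τ + ∫ t in s..τ, IccExtend hab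
        (pointwiseCLM (hL.derivAlong hx.continuous hu a b) (phasePairCLM hab s y)) t) ∧
      HasStrictFDerivAt (fun z : ℝ × PhaseSpace S (EuclideanSpace ℝ (Fin m)) a b =>
        ∫ t in s..z.1, IccExtend hab
          (nemytskii (F := fun z t => L z.1 z.2 t) hL.1 (phasePair hab s (x s) z.2)) t) D
        (τ, phaseCoord S a b hx hu) := by
  obtain ⟨D, hD, h⟩ := hasStrictFDerivAt_phase_integral (S := S) hab s (x s)
    (F := fun z t => L z.1 z.2 t) hL.1 hL.2.2 hL.hasFDerivAt τ (phaseCoord S a b hx hu)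
  refine ⟨D, fun d y => ?_, h⟩
  rw [hD]
  congr 1
  · rw [IccExtend_of_mem _ _ hτ, nemytskii_apply, phasePair_phaseCoord hab hx hu hs]
    rfl
  · congr! 4
    ext1 t
    change stateControlDeriv L (phasePair hab s (x s) (phaseCoord S a b hx hu) t) t _ = _
    rw [phasePair_phaseCoord hab hx hu hs]
    rfl

namespace SwitchedProblem

variable (P : SwitchedProblem n m) (hab : P.t₀ ≤ P.tf)

/-- The process with given switching time and phase coordinates. -/
noncomputable def processOf (c₁ c₂ : EuclideanSpace ℝ (Fin n))
    (z : ℝ × PhaseSpace (⊥ : Submodule ℝ (EuclideanSpace ℝ (Fin n)))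
      (EuclideanSpace ℝ (Fin m)) P.t₀ P.tf ×
      PhaseSpace S (EuclideanSpace ℝ (Fin m)) P.t₀ P.tf) : SwitchedProcess n m where
  τ := z.1
  x₁ := phaseState hab P.t₀ c₁ z.2.1
  x₂ := phaseState hab P.tf c₂ z.2.2
  u₁ := IccExtend hab z.2.1.2.2
  u₂ := IccExtend hab z.2.2.2.2

/-- The equality constraints in phase coordinates. -/
noncomputable def constraintMap (hP : P.Regular) (c₁ c₂ : EuclideanSpace ℝ (Fin n))
    (z : ℝ × PhaseSpace (⊥ : Submodule ℝ (EuclideanSpace ℝ (Fin n)))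
      (EuclideanSpace ℝ (Fin m)) P.t₀ P.tf ×
      PhaseSpace S (EuclideanSpace ℝ (Fin m)) P.t₀ P.tf) :
    C(Icc P.t₀ P.tf, EuclideanSpace ℝ (Fin n)) × C(Icc P.t₀ P.tf, EuclideanSpace ℝ (Fin n)) ×
      ℝ × EuclideanSpace ℝ (Fin n) :=
  (z.2.1.2.1 - nemytskii (F := fun z t => P.f₁ z.1 z.2 t) hP.f₁.1 (phasePair hab P.t₀ c₁ z.2.1),
    z.2.2.2.1 - nemytskii (F := fun z t => P.f₂ z.1 z.2 t) hP.f₂.1 (phasePair hab P.tf c₂ z.2.2),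
    P.g (phaseState hab P.t₀ c₁ z.2.1 z.1),
    phaseState hab P.tf c₂ z.2.2 z.1 - phaseState hab P.t₀ c₁ z.2.1 z.1)

/-- The cost in phase coordinates. -/
noncomputable def coordCost (hP : P.Regular) (c₁ c₂ : EuclideanSpace ℝ (Fin n))
    (z : ℝ × PhaseSpace (⊥ : Submodule ℝ (EuclideanSpace ℝ (Fin n)))
      (EuclideanSpace ℝ (Fin m)) P.t₀ P.tf ×
      PhaseSpace S (EuclideanSpace ℝ (Fin m)) P.t₀ P.tf) : ℝ :=
  P.φ (c₂ + z.2.2.1) +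
    (∫ t in P.t₀..z.1, IccExtend hab
      (nemytskii (F := fun z t => P.L₁ z.1 z.2 t) hP.L₁.1 (phasePair hab P.t₀ c₁ z.2.1)) t) -
    ∫ t in P.tf..z.1, IccExtend hab
      (nemytskii (F := fun z t => P.L₂ z.1 z.2 t) hP.L₂.1 (phasePair hab P.tf c₂ z.2.2)) t

variable {P}

theorem cost_processOf (hP : P.Regular) (c₁ c₂ : EuclideanSpace ℝ (Fin n))
    (z : ℝ × PhaseSpace (⊥ : Submodule ℝ (EuclideanSpace ℝ (Fin n)))
      (EuclideanSpace ℝ (Fin m)) P.t₀ P.tf ×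
      PhaseSpace S (EuclideanSpace ℝ (Fin m)) P.t₀ P.tf) (hz : z.1 ∈ Icc P.t₀ P.tf) :
    P.cost (P.processOf hab c₁ c₂ z) = P.coordCost hab hP c₁ c₂ z := by
  rw [cost, coordCost, sub_eq_add_neg, ← intervalIntegral.integral_symm]
  congr 1
  · congr 1
    · simp [processOf]
    · refine intervalIntegral.integral_congr fun t ht => ?_
      have ht' : t ∈ Icc P.t₀ P.tf := ordConnected_Icc.uIcc_subset ⟨le_rfl, hab⟩ hz ht
      simp only [processOf]
      rw [IccExtend_of_mem _ _ ht', IccExtend_of_mem _ _ ht', nemytskii_apply, phasePair_apply]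
  · refine intervalIntegral.integral_congr fun t ht => ?_
    have ht' : t ∈ Icc P.t₀ P.tf := ordConnected_Icc.uIcc_subset hz ⟨hab, le_rfl⟩ ht
    simp only [processOf]
    rw [IccExtend_of_mem _ _ ht', IccExtend_of_mem _ _ ht', nemytskii_apply, phasePair_apply]

variable {p : SwitchedProcess n m}

/-- Coordinates of an admissible process. -/
noncomputable def Admissible.coord (hp : P.Admissible p)
    (S : Submodule ℝ (EuclideanSpace ℝ (Fin n))) :
    ℝ × PhaseSpace (⊥ : Submodule ℝ (EuclideanSpace ℝ (Fin n)))
      (EuclideanSpace ℝ (Fin m)) P.t₀ P.tf ×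
      PhaseSpace S (EuclideanSpace ℝ (Fin m)) P.t₀ P.tf :=
  (p.τ, phaseCoord ⊥ P.t₀ P.tf hp.x₁_C1 hp.u₁_cont, phaseCoord S P.t₀ P.tf hp.x₂_C1 hp.u₂_cont)

theorem Admissible.le (hp : P.Admissible p) : P.t₀ ≤ P.tf := (hp.t₀_lt.trans hp.lt_tf).le

/-- Near a transversal process whose dynamics hold slightly beyond the switch, the equality
constraints imply admissibility. -/
theorem Admissible.eventually_admissible (hP : P.Regular) (hp : P.Admissible p) {η : ℝ}
    (hη : 0 < η)
    (ext₁ : ∀ t ∈ Icc P.t₀ (p.τ + η), HasDerivAt p.x₁ (P.f₁ (p.x₁ t) (p.u₁ t) t) t)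
    (ext₂ : ∀ t ∈ Icc (p.τ - η) P.tf, HasDerivAt p.x₂ (P.f₂ (p.x₂ t) (p.u₂ t) t) t)
    (h₁ : 0 < ⟪P.normal p, P.f₁At p⟫_ℝ) (h₂ : 0 < ⟪P.normal p, P.f₂At p⟫_ℝ)
    (hS : P.target ≠ none → S = ⊥) :
    ∀ᶠ z in 𝓝 (hp.coord S), P.constraintMap hp.le hP (p.x₁ P.t₀) (p.x₂ P.tf) z =
        P.constraintMap hp.le hP (p.x₁ P.t₀) (p.x₂ P.tf) (hp.coord S) →
      P.Admissible (P.processOf hp.le (p.x₁ P.t₀) (p.x₂ P.tf) z) := by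
  have hab := hp.le
  have ha : P.t₀ ∈ Icc P.t₀ P.tf := ⟨le_rfl, hab⟩
  have hb : P.tf ∈ Icc P.t₀ P.tf := ⟨hab, le_rfl⟩
  have hτ : p.τ ∈ Icc P.t₀ P.tf := ⟨hp.t₀_lt.le, hp.lt_tf.le⟩
  set c₁ := p.x₁ P.t₀
  set c₂ := p.x₂ P.tf
  have hgc := hP.g.continuous
  have hmono : ∀ (s c : _) (T : Submodule ℝ (EuclideanSpace ℝ (Fin n)))
      (q₀ : PhaseSpace T (EuclideanSpace ℝ (Fin m)) P.t₀ P.tf),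
      0 < fderiv ℝ P.g (phaseState hab s c q₀ p.τ) (IccExtend hab q₀.2.1 p.τ) →
      ∃ ε > 0, ∀ᶠ q in 𝓝 q₀, StrictMonoOn (fun t => P.g (phaseState hab s c q t))
        (Icc (p.τ - ε) (p.τ + ε)) := fun s c T q₀ hpos =>
    exists_eventually_strictMonoOn (fun q t =>
      (hP.g.differentiable one_ne_zero _).hasFDerivAt.comp_hasDerivAt t
        (hasDerivAt_phaseState hab s c q t))
      (((hP.g.continuous_fderiv one_ne_zero).comp
        (continuous_phaseState_uncurry hab s c)).clm_apply
        ((continuous_iccExtend_uncurry hab).comp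
          (continuous_fst.prodMk (continuous_snd.snd.fst)))) hpos
  have hx₁ : ∀ t ∈ Icc P.t₀ P.tf, phaseState hab P.t₀ c₁
      (phaseCoord ⊥ P.t₀ P.tf hp.x₁_C1 hp.u₁_cont) t = p.x₁ t := fun t ht =>
    phaseState_phaseCoord hab _ _ ha ht
  have hx₂ : ∀ t ∈ Icc P.t₀ P.tf, phaseState hab P.tf c₂
      (phaseCoord S P.t₀ P.tf hp.x₂_C1 hp.u₂_cont) t = p.x₂ t := fun t ht =>
    phaseState_phaseCoord hab _ _ hb ht
  obtain ⟨ε₁, hε₁, hm₁⟩ := hmono P.t₀ c₁ ⊥ (phaseCoord ⊥ P.t₀ P.tf hp.x₁_C1 hp.u₁_cont) (by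
    rw [hx₁ _ hτ, iccExtend_phaseCoord hab _ _ hτ, hp.f₁At_eq, ← inner_normal]
    exact h₁)
  obtain ⟨ε₂, hε₂, hm₂⟩ := hmono P.tf c₂ S (phaseCoord S P.t₀ P.tf hp.x₂_C1 hp.u₂_cont) (by
    rw [hx₂ _ hτ, iccExtend_phaseCoord hab _ _ hτ, hp.f₂At_eq, ← hp.junction, ← inner_normal]
    exact h₂)
  have hbefore := eventually_neg_before (c := P.t₀)
    (hgc.comp (continuous_phaseState_uncurry hab P.t₀ c₁)) hε₁ hm₁ fun t ht => by
      rw [hx₁ t ⟨ht.1, by linarith [ht.2, hτ.2]⟩]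
      exact hp.before t ⟨ht.1, by linarith [ht.2]⟩
  have hafter := eventually_pos_after (c := P.tf)
    (hgc.comp (continuous_phaseState_uncurry hab P.tf c₂)) hε₂ hm₂ fun t ht => by
      rw [hx₂ t ⟨by linarith [ht.1, hτ.1], ht.2⟩]
      exact hp.after t ⟨by linarith [ht.1], ht.2⟩
  have t₁ : Tendsto (fun z : ℝ × PhaseSpace (⊥ : Submodule ℝ (EuclideanSpace ℝ (Fin n)))
      (EuclideanSpace ℝ (Fin m)) P.t₀ P.tf ×
      PhaseSpace S (EuclideanSpace ℝ (Fin m)) P.t₀ P.tf => (z.1, z.2.1)) (𝓝 (hp.coord S))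
      (𝓝 (p.τ, phaseCoord ⊥ P.t₀ P.tf hp.x₁_C1 hp.u₁_cont)) :=
    (continuous_fst.prodMk continuous_snd.fst).tendsto (hp.coord S)
  have t₂ : Tendsto (fun z : ℝ × PhaseSpace (⊥ : Submodule ℝ (EuclideanSpace ℝ (Fin n)))
      (EuclideanSpace ℝ (Fin m)) P.t₀ P.tf ×
      PhaseSpace S (EuclideanSpace ℝ (Fin m)) P.t₀ P.tf => (z.1, z.2.2)) (𝓝 (hp.coord S))
      (𝓝 (p.τ, phaseCoord S P.t₀ P.tf hp.x₂_C1 hp.u₂_cont)) :=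
    (continuous_fst.prodMk continuous_snd.snd).tendsto (hp.coord S)
  have hT : ∀ᶠ T in 𝓝 p.τ, T ∈ Ioo P.t₀ P.tf ∩ Icc (p.τ - η) (p.τ + η) :=
    inter_mem (Ioo_mem_nhds hp.t₀_lt hp.lt_tf) (Icc_mem_nhds (by linarith) (by linarith))
  filter_upwards [t₁.eventually hbefore, t₂.eventually hafter,
    (continuous_fst.tendsto (hp.coord S)).eventually hT]
  rintro ⟨T, q₁, q₂⟩ hbef haft ⟨hTI, hTη⟩ hG
  dsimp only at hbef haft hTI hTη
  simp only [constraintMap, Admissible.coord, Prod.mk.injEq] at hG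
  obtain ⟨e₁, e₂, e₃, e₄⟩ := hG
  rw [hx₁ _ hτ, hp.crossing] at e₃
  rw [hx₁ _ hτ, hx₂ _ hτ, hp.junction, sub_self, sub_eq_zero] at e₄
  -- On the level set the defect of `q₁` equals that of `p`, which need not vanish everywhere but
  -- does so up to `τ + η`. This covers the perturbed phase `[t₀, T]` even when `T > τ`.
  have d₁ : ∀ t ∈ Icc P.t₀ P.tf, t ≤ p.τ + η →
      IccExtend hab q₁.2.1 t = P.f₁ (phaseState hab P.t₀ c₁ q₁ t) (IccExtend hab q₁.2.2 t) t := by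
    intro t ht htη
    have h := DFunLike.congr_fun e₁ ⟨t, ht⟩
    simp only [ContinuousMap.sub_apply, nemytskii_apply, phasePair_apply] at h
    rw [hx₁ t ht] at h
    simp only [phaseCoord, ContinuousMap.coe_mk] at h
    rw [(ext₁ t ⟨ht.1, htη⟩).deriv, sub_self, sub_eq_zero] at h
    rw [IccExtend_of_mem _ _ ht, IccExtend_of_mem _ _ ht]
    exact h
  have d₂ : ∀ t ∈ Icc P.t₀ P.tf, p.τ - η ≤ t →
      IccExtend hab q₂.2.1 t = P.f₂ (phaseState hab P.tf c₂ q₂ t) (IccExtend hab q₂.2.2 t) t := by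
    intro t ht htη
    have h := DFunLike.congr_fun e₂ ⟨t, ht⟩
    simp only [ContinuousMap.sub_apply, nemytskii_apply, phasePair_apply] at h
    rw [hx₂ t ht] at h
    simp only [phaseCoord, ContinuousMap.coe_mk] at h
    rw [(ext₂ t ⟨htη, ht.2⟩).deriv, sub_self, sub_eq_zero] at h
    rw [IccExtend_of_mem _ _ ht, IccExtend_of_mem _ _ ht]
    exact h
  have hq₁ : (q₁.1 : EuclideanSpace ℝ (Fin n)) = 0 := (Submodule.mem_bot ℝ).1 q₁.1.2
  refine ⟨hTI.1, hTI.2, continuous_iccExtend hab _, continuous_iccExtend hab _,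
    contDiff_phaseState hab _ _ _, contDiff_phaseState hab _ _ _, fun t ht => ?_, fun t ht => ?_,
    ?_, fun xf hxf => ?_, e₄.symm, hbef e₃, e₃, haft ?_⟩
  · exact (hasDerivAt_phaseState hab _ _ q₁ t).congr_deriv
      (d₁ t ⟨ht.1, ht.2.trans hTI.2.le⟩ (ht.2.trans hTη.2))
  · exact (hasDerivAt_phaseState hab _ _ q₂ t).congr_deriv
      (d₂ t ⟨hTI.1.le.trans ht.1, ht.2⟩ (hTη.1.trans ht.1))
  · simp only [processOf, phaseState_self]
    rw [hq₁, add_zero]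
    exact hp.init
  · have hS' := hS (fun h => by simp [h] at hxf)
    subst hS'
    have hq₂ : (q₂.1 : EuclideanSpace ℝ (Fin n)) = 0 := (Submodule.mem_bot ℝ).1 q₂.1.2
    simp only [processOf, phaseState_self]
    rw [hq₂, add_zero]
    exact hp.final xf hxf
  · rw [e₄]
    exact e₃

theorem Admissible.processOf_coord_cost (hP : P.Regular) (hp : P.Admissible p) :
    P.coordCost hp.le hP (p.x₁ P.t₀) (p.x₂ P.tf) (hp.coord S) = P.cost p := by
  have ha : P.t₀ ∈ Icc P.t₀ P.tf := ⟨le_rfl, hp.le⟩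
  have hb : P.tf ∈ Icc P.t₀ P.tf := ⟨hp.le, le_rfl⟩
  have hτ : p.τ ∈ Icc P.t₀ P.tf := ⟨hp.t₀_lt.le, hp.lt_tf.le⟩
  rw [cost, coordCost, sub_eq_add_neg, ← intervalIntegral.integral_symm]
  congr 1
  · congr 1
    · simp [Admissible.coord, phaseCoord]
    · refine intervalIntegral.integral_congr fun t ht => ?_
      have ht' : t ∈ Icc P.t₀ P.tf := ordConnected_Icc.uIcc_subset ha hτ ht
      simp only [Admissible.coord]
      rw [IccExtend_of_mem _ _ ht', nemytskii_apply, phasePair_phaseCoord _ _ _ ha]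
  · refine intervalIntegral.integral_congr fun t ht => ?_
    have ht' : t ∈ Icc P.t₀ P.tf := ordConnected_Icc.uIcc_subset hτ hb ht
    simp only [Admissible.coord]
    rw [IccExtend_of_mem _ _ ht', nemytskii_apply, phasePair_phaseCoord _ _ _ hb]

/-- Strict derivative of the equality constraints at an admissible process. -/
theorem Admissible.hasStrictFDerivAt_constraintMap (hP : P.Regular) (hp : P.Admissible p)
    (S : Submodule ℝ (EuclideanSpace ℝ (Fin n))) :
    ∃ D : (ℝ × PhaseSpace (⊥ : Submodule ℝ (EuclideanSpace ℝ (Fin n)))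
      (EuclideanSpace ℝ (Fin m)) P.t₀ P.tf × PhaseSpace S (EuclideanSpace ℝ (Fin m)) P.t₀ P.tf) →L[ℝ]
        C(Icc P.t₀ P.tf, EuclideanSpace ℝ (Fin n)) × C(Icc P.t₀ P.tf, EuclideanSpace ℝ (Fin n)) ×
          ℝ × EuclideanSpace ℝ (Fin n),
      (∀ d y₁ y₂, D (d, y₁, y₂) =
        (y₁.2.1 - pointwiseCLM (hP.f₁.derivAlong hp.x₁_C1.continuous hp.u₁_cont _ _)
              (phasePairCLM hp.le P.t₀ y₁),
            y₂.2.1 - pointwiseCLM (hP.f₂.derivAlong hp.x₂_C1.continuous hp.u₂_cont _ _)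
              (phasePairCLM hp.le P.tf y₂),
            ⟪P.normal p, d • P.f₁At p + phaseState hp.le P.t₀ 0 y₁ p.τ⟫_ℝ,
            d • (P.f₂At p - P.f₁At p) +
              (phaseState hp.le P.tf 0 y₂ p.τ - phaseState hp.le P.t₀ 0 y₁ p.τ))) ∧
      HasStrictFDerivAt (P.constraintMap hp.le hP (p.x₁ P.t₀) (p.x₂ P.tf)) D (hp.coord S) := by
  have hab := hp.le
  have ha : P.t₀ ∈ Icc P.t₀ P.tf := ⟨le_rfl, hab⟩
  have hb : P.tf ∈ Icc P.t₀ P.tf := ⟨hab, le_rfl⟩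
  have hτ : p.τ ∈ Icc P.t₀ P.tf := ⟨hp.t₀_lt.le, hp.lt_tf.le⟩
  let X := ℝ × PhaseSpace (⊥ : Submodule ℝ (EuclideanSpace ℝ (Fin n)))
      (EuclideanSpace ℝ (Fin m)) P.t₀ P.tf × PhaseSpace S (EuclideanSpace ℝ (Fin m)) P.t₀ P.tf
  let z₀ : X := hp.coord S
  let π₁ : X →L[ℝ] PhaseSpace (⊥ : Submodule ℝ (EuclideanSpace ℝ (Fin n)))
      (EuclideanSpace ℝ (Fin m)) P.t₀ P.tf :=
    (ContinuousLinearMap.fst ℝ _ _).comp (ContinuousLinearMap.snd ℝ _ _)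
  let π₂ : X →L[ℝ] PhaseSpace S (EuclideanSpace ℝ (Fin m)) P.t₀ P.tf :=
    (ContinuousLinearMap.snd ℝ _ _).comp (ContinuousLinearMap.snd ℝ _ _)
  let ρ₁ : X →L[ℝ] ℝ × PhaseSpace (⊥ : Submodule ℝ (EuclideanSpace ℝ (Fin n)))
      (EuclideanSpace ℝ (Fin m)) P.t₀ P.tf := (ContinuousLinearMap.fst ℝ _ _).prod π₁
  let ρ₂ : X →L[ℝ] ℝ × PhaseSpace S (EuclideanSpace ℝ (Fin m)) P.t₀ P.tf :=
    (ContinuousLinearMap.fst ℝ _ _).prod π₂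
  obtain ⟨D₁, hD₁, hd₁⟩ := hasStrictFDerivAt_defect (S := ⊥) hab hP.f₁ hp.x₁_C1 hp.u₁_cont ha
  obtain ⟨D₂, hD₂, hd₂⟩ := hasStrictFDerivAt_defect (S := S) hab hP.f₂ hp.x₂_C1 hp.u₂_cont hb
  obtain ⟨Y₁, hY₁, hy₁⟩ := hasStrictFDerivAt_phaseState hab P.t₀ (p.x₁ P.t₀) p.τ
    (phaseCoord ⊥ P.t₀ P.tf hp.x₁_C1 hp.u₁_cont)
  obtain ⟨Y₂, hY₂, hy₂⟩ := hasStrictFDerivAt_phaseState hab P.tf (p.x₂ P.tf) p.τ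
    (phaseCoord S P.t₀ P.tf hp.x₂_C1 hp.u₂_cont)
  have s₁ : HasStrictFDerivAt (fun z : X => _) (D₁.comp π₁) z₀ := hd₁.comp z₀ π₁.hasStrictFDerivAt
  have s₂ : HasStrictFDerivAt (fun z : X => _) (D₂.comp π₂) z₀ := hd₂.comp z₀ π₂.hasStrictFDerivAt
  have s₃ : HasStrictFDerivAt (fun z : X => phaseState hab P.t₀ (p.x₁ P.t₀) z.2.1 z.1)
      (Y₁.comp ρ₁) z₀ := HasStrictFDerivAt.comp (f := ρ₁) z₀ hy₁ ρ₁.hasStrictFDerivAt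
  have s₄ : HasStrictFDerivAt (fun z : X => phaseState hab P.tf (p.x₂ P.tf) z.2.2 z.1)
      (Y₂.comp ρ₂) z₀ := HasStrictFDerivAt.comp (f := ρ₂) z₀ hy₂ ρ₂.hasStrictFDerivAt
  have g₁ : HasStrictFDerivAt P.g (fderiv ℝ P.g (p.x₁ p.τ))
      (phaseState hab P.t₀ (p.x₁ P.t₀) z₀.2.1 z₀.1) := by
    rw [show phaseState hab P.t₀ (p.x₁ P.t₀) z₀.2.1 z₀.1 = p.x₁ p.τ from
      phaseState_phaseCoord hab hp.x₁_C1 hp.u₁_cont ha hτ]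
    exact hP.g.contDiffAt.hasStrictFDerivAt one_ne_zero
  have s₅ : HasStrictFDerivAt (fun z : X => P.g (phaseState hab P.t₀ (p.x₁ P.t₀) z.2.1 z.1))
      ((fderiv ℝ P.g (p.x₁ p.τ)).comp (Y₁.comp ρ₁)) z₀ := g₁.comp z₀ s₃
  refine ⟨(D₁.comp π₁).prod ((D₂.comp π₂).prod (((fderiv ℝ P.g (p.x₁ p.τ)).comp
    (Y₁.comp ρ₁)).prod (Y₂.comp ρ₂ - Y₁.comp ρ₁))), fun d y₁ y₂ => ?_,
    s₁.prodMk (s₂.prodMk (s₅.prodMk (s₄.sub s₃)))⟩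
  change (D₁ y₁, D₂ y₂, fderiv ℝ P.g (p.x₁ p.τ) (Y₁ (d, y₁)), Y₂ (d, y₂) - Y₁ (d, y₁)) = _
  rw [hD₁, hD₂, ← inner_normal, hY₁, hY₂, iccExtend_phaseCoord hab _ _ hτ,
    iccExtend_phaseCoord hab _ _ hτ, hp.f₁At_eq, hp.f₂At_eq, smul_sub]
  congr 3
  abel

/-- Strict derivative of the cost at an admissible process. -/
theorem Admissible.hasStrictFDerivAt_coordCost (hP : P.Regular) (hp : P.Admissible p)
    (S : Submodule ℝ (EuclideanSpace ℝ (Fin n))) :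
    ∃ D : (ℝ × PhaseSpace (⊥ : Submodule ℝ (EuclideanSpace ℝ (Fin n)))
      (EuclideanSpace ℝ (Fin m)) P.t₀ P.tf × PhaseSpace S (EuclideanSpace ℝ (Fin m)) P.t₀ P.tf) →L[ℝ] ℝ,
      (∀ d y₁ y₂, D (d, y₁, y₂) = fderiv ℝ P.φ (p.x₂ P.tf) y₂.1 - d * P.jumpL p +
            (∫ t in P.t₀..p.τ, IccExtend hp.le (pointwiseCLM
              (hP.L₁.derivAlong hp.x₁_C1.continuous hp.u₁_cont _ _)
                (phasePairCLM hp.le P.t₀ y₁)) t) -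
            ∫ t in P.tf..p.τ, IccExtend hp.le (pointwiseCLM
              (hP.L₂.derivAlong hp.x₂_C1.continuous hp.u₂_cont _ _)
                (phasePairCLM hp.le P.tf y₂)) t) ∧
      HasStrictFDerivAt (P.coordCost hp.le hP (p.x₁ P.t₀) (p.x₂ P.tf)) D (hp.coord S) := by
  have hab := hp.le
  have ha : P.t₀ ∈ Icc P.t₀ P.tf := ⟨le_rfl, hab⟩
  have hb : P.tf ∈ Icc P.t₀ P.tf := ⟨hab, le_rfl⟩
  have hτ : p.τ ∈ Icc P.t₀ P.tf := ⟨hp.t₀_lt.le, hp.lt_tf.le⟩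
  let X := ℝ × PhaseSpace (⊥ : Submodule ℝ (EuclideanSpace ℝ (Fin n)))
      (EuclideanSpace ℝ (Fin m)) P.t₀ P.tf × PhaseSpace S (EuclideanSpace ℝ (Fin m)) P.t₀ P.tf
  let z₀ : X := hp.coord S
  let π₁ : X →L[ℝ] PhaseSpace (⊥ : Submodule ℝ (EuclideanSpace ℝ (Fin n)))
      (EuclideanSpace ℝ (Fin m)) P.t₀ P.tf :=
    (ContinuousLinearMap.fst ℝ _ _).comp (ContinuousLinearMap.snd ℝ _ _)
  let π₂ : X →L[ℝ] PhaseSpace S (EuclideanSpace ℝ (Fin m)) P.t₀ P.tf :=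
    (ContinuousLinearMap.snd ℝ _ _).comp (ContinuousLinearMap.snd ℝ _ _)
  let ρ₁ : X →L[ℝ] ℝ × PhaseSpace (⊥ : Submodule ℝ (EuclideanSpace ℝ (Fin n)))
      (EuclideanSpace ℝ (Fin m)) P.t₀ P.tf := (ContinuousLinearMap.fst ℝ _ _).prod π₁
  let ρ₂ : X →L[ℝ] ℝ × PhaseSpace S (EuclideanSpace ℝ (Fin m)) P.t₀ P.tf :=
    (ContinuousLinearMap.fst ℝ _ _).prod π₂
  obtain ⟨C₁, hC₁, hc₁⟩ := hasStrictFDerivAt_runningCost (S := ⊥) hab hP.L₁ hp.x₁_C1 hp.u₁_cont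
    ha hτ
  obtain ⟨C₂, hC₂, hc₂⟩ := hasStrictFDerivAt_runningCost (S := S) hab hP.L₂ hp.x₂_C1 hp.u₂_cont
    hb hτ
  have φ₁ : HasStrictFDerivAt P.φ (fderiv ℝ P.φ (p.x₂ P.tf))
      (p.x₂ P.tf + S.subtypeL.comp ((ContinuousLinearMap.fst ℝ _ _).comp π₂) z₀) := by
    rw [show p.x₂ P.tf + S.subtypeL.comp ((ContinuousLinearMap.fst ℝ _ _).comp π₂) z₀ =
      p.x₂ P.tf from add_zero _]
    exact hP.φ.contDiffAt.hasStrictFDerivAt one_ne_zero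
  have s₆ : HasStrictFDerivAt (fun z : X => P.φ (p.x₂ P.tf + z.2.2.1))
      ((fderiv ℝ P.φ (p.x₂ P.tf)).comp (S.subtypeL.comp ((ContinuousLinearMap.fst ℝ _ _).comp π₂)))
      z₀ :=
    φ₁.comp z₀ (((S.subtypeL.comp ((ContinuousLinearMap.fst ℝ _ _).comp
      π₂)).hasStrictFDerivAt).const_add (p.x₂ P.tf))
  have r₁ : HasStrictFDerivAt (fun z : X => _) (C₁.comp ρ₁) z₀ := hc₁.comp z₀ ρ₁.hasStrictFDerivAt
  have r₂ : HasStrictFDerivAt (fun z : X => _) (C₂.comp ρ₂) z₀ := hc₂.comp z₀ ρ₂.hasStrictFDerivAt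
  refine ⟨(fderiv ℝ P.φ (p.x₂ P.tf)).comp (S.subtypeL.comp ((ContinuousLinearMap.fst ℝ _ _).comp
    π₂)) + C₁.comp ρ₁ - C₂.comp ρ₂, fun d y₁ y₂ => ?_, (s₆.add r₁).sub r₂⟩
  change fderiv ℝ P.φ (p.x₂ P.tf) y₂.1 + C₁ (d, y₁) - C₂ (d, y₂) = _
  rw [hC₁, hC₂, jumpL]
  ring

/-- Lagrange multipliers (on the constraint space, as algebraic functionals) of an optimal process
with transversal crossing. -/
theorem IsOptimal.exists_multipliers (hP : P.Regular) (ho : P.IsOptimal p) {η : ℝ} (hη : 0 < η)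
    (ext₁ : ∀ t ∈ Icc P.t₀ (p.τ + η), HasDerivAt p.x₁ (P.f₁ (p.x₁ t) (p.u₁ t) t) t)
    (ext₂ : ∀ t ∈ Icc (p.τ - η) P.tf, HasDerivAt p.x₂ (P.f₂ (p.x₂ t) (p.u₂ t) t) t)
    (h₁ : 0 < ⟪P.normal p, P.f₁At p⟫_ℝ) (h₂ : 0 < ⟪P.normal p, P.f₂At p⟫_ℝ)
    (hS : P.target ≠ none → S = ⊥) :
    ∃ (Λ : Module.Dual ℝ (C(Icc P.t₀ P.tf, EuclideanSpace ℝ (Fin n)) ×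
        C(Icc P.t₀ P.tf, EuclideanSpace ℝ (Fin n)) × ℝ × EuclideanSpace ℝ (Fin n))) (a : ℝ),
      (Λ, a) ≠ 0 ∧
      ∀ (d : ℝ) (y₁ : PhaseSpace (⊥ : Submodule ℝ (EuclideanSpace ℝ (Fin n)))
          (EuclideanSpace ℝ (Fin m)) P.t₀ P.tf)
        (y₂ : PhaseSpace S (EuclideanSpace ℝ (Fin m)) P.t₀ P.tf),
        Λ (y₁.2.1 - pointwiseCLM (hP.f₁.derivAlong ho.1.x₁_C1.continuous ho.1.u₁_cont _ _)
              (phasePairCLM ho.1.le P.t₀ y₁),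
            y₂.2.1 - pointwiseCLM (hP.f₂.derivAlong ho.1.x₂_C1.continuous ho.1.u₂_cont _ _)
              (phasePairCLM ho.1.le P.tf y₂),
            ⟪P.normal p, d • P.f₁At p + phaseState ho.1.le P.t₀ 0 y₁ p.τ⟫_ℝ,
            d • (P.f₂At p - P.f₁At p) +
              (phaseState ho.1.le P.tf 0 y₂ p.τ - phaseState ho.1.le P.t₀ 0 y₁ p.τ)) +
          a * (fderiv ℝ P.φ (p.x₂ P.tf) y₂.1 - d * P.jumpL p +
            (∫ t in P.t₀..p.τ, IccExtend ho.1.le (pointwiseCLM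
              (hP.L₁.derivAlong ho.1.x₁_C1.continuous ho.1.u₁_cont _ _)
                (phasePairCLM ho.1.le P.t₀ y₁)) t) -
            ∫ t in P.tf..p.τ, IccExtend ho.1.le (pointwiseCLM
              (hP.L₂.derivAlong ho.1.x₂_C1.continuous ho.1.u₂_cont _ _)
                (phasePairCLM ho.1.le P.tf y₂)) t) = 0 := by
  have hp := ho.1
  obtain ⟨G', hG', hG⟩ := hp.hasStrictFDerivAt_constraintMap hP S
  obtain ⟨Φ', hΦ', hΦ⟩ := hp.hasStrictFDerivAt_coordCost hP S
  have hmin : IsLocalExtrOn (P.coordCost hp.le hP (p.x₁ P.t₀) (p.x₂ P.tf) (S := S))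
      {z | P.constraintMap hp.le hP (p.x₁ P.t₀) (p.x₂ P.tf) z =
        P.constraintMap hp.le hP (p.x₁ P.t₀) (p.x₂ P.tf) (hp.coord S)} (hp.coord S) := by
    refine Or.inl ?_
    have hadm := hp.eventually_admissible hP hη ext₁ ext₂ h₁ h₂ hS
    filter_upwards [mem_nhdsWithin_of_mem_nhds hadm, self_mem_nhdsWithin] with z hz hzG
    have hza := hz hzG
    rw [hp.processOf_coord_cost hP, ← cost_processOf hp.le hP _ _ z ⟨hza.t₀_lt.le, hza.lt_tf.le⟩]
    exact ho.2 _ hza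
  -- At a local extremum the joint derivative of constraints and cost cannot be onto, so some
  -- nonzero linear functional, possibly discontinuous, kills its range.
  obtain ⟨Λ, a, hne, hΛ⟩ := hmin.exists_linear_map_of_hasStrictFDerivAt hG hΦ
  refine ⟨Λ, a, hne, fun d y₁ y₂ => ?_⟩
  rw [← hG', ← hΦ']
  exact hΛ (d, y₁, y₂)

end SwitchedProblem

end Multipliers

/-! ### Representation of the multipliers by co-states -/

section Representation

open Set
open scoped Topology

variable {n m : ℕ} {S : Submodule ℝ (EuclideanSpace ℝ (Fin n))} {a b s : ℝ} (hab : a ≤ b)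

/-- The linearized dynamics with an inhomogeneity are solvable, with data at any time. -/
theorem exists_linearized_solution
    (A : C(Icc a b, EuclideanSpace ℝ (Fin n) × EuclideanSpace ℝ (Fin m) →L[ℝ]
      EuclideanSpace ℝ (Fin n))) (h : C(Icc a b, EuclideanSpace ℝ (Fin n))) (hs : s ∈ Icc a b)
    {r : ℝ} (hr : r ∈ Icc a b) (c : EuclideanSpace ℝ (Fin n)) :
    ∃ (y : ℝ → EuclideanSpace ℝ (Fin n)) (w : C(Icc a b, EuclideanSpace ℝ (Fin n))),
      Continuous y ∧ y r = c ∧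
      (∀ t ∈ Icc a b, HasDerivAt y (IccExtend hab A t (y t, 0) + IccExtend hab h t) t) ∧
      ∀ σ : S, (σ : EuclideanSpace ℝ (Fin n)) = y s →
        (∀ t ∈ Icc a b, phaseState hab s 0 ((σ, w, 0) :
          PhaseSpace S (EuclideanSpace ℝ (Fin m)) a b) t = y t) ∧
        w - pointwiseCLM A (phasePairCLM hab s (σ, w, 0)) = h := by
  have hA : Continuous fun t => (IccExtend hab A t).comp
      (ContinuousLinearMap.inl ℝ (EuclideanSpace ℝ (Fin n)) (EuclideanSpace ℝ (Fin m))) :=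
    A.continuous.Icc_extend'.clm_comp continuous_const
  obtain ⟨y, hy, hyr, hyd⟩ := exists_linear_ode_solution hA (continuous_iccExtend hab h) hr c
  have hw : Continuous fun t : ℝ => IccExtend hab A t (y t, 0) + IccExtend hab h t :=
    (A.continuous.Icc_extend'.clm_apply (hy.prodMk continuous_const)).add
      (continuous_iccExtend hab h)
  let w : C(Icc a b, EuclideanSpace ℝ (Fin n)) := ⟨_, hw.comp continuous_subtype_val⟩
  refine ⟨y, w, hy, hyr, hyd, fun σ hσ => ?_⟩
  have hstate : ∀ t ∈ Icc a b, phaseState hab s 0 ((σ, w, 0) :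
      PhaseSpace S (EuclideanSpace ℝ (Fin m)) a b) t = y t := fun t ht => by
    have h1 : ∫ r in s..t, IccExtend hab w r = y t - y s := by
      rw [← intervalIntegral.integral_eq_sub_of_hasDerivAt (f := y)
        (fun r hr => hyd r (ordConnected_Icc.uIcc_subset hs ht hr)) (hw.intervalIntegrable _ _)]
      refine intervalIntegral.integral_congr fun r hr => ?_
      rw [IccExtend_of_mem _ _ (ordConnected_Icc.uIcc_subset hs ht hr)]
      rfl
    rw [phaseState, h1, hσ]
    abel
  refine ⟨hstate, ?_⟩
  ext1 t
  rw [ContinuousMap.sub_apply, pointwiseCLM_apply, phasePairCLM_apply, hstate t t.2]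
  change (IccExtend hab A t (y t, 0) + IccExtend hab h t) - A t (y t, 0) = h t
  rw [IccExtend_of_mem _ _ t.2, IccExtend_of_mem _ _ t.2]
  exact add_sub_cancel_left _ _

/-- Existence of a solution of the adjoint equation with prescribed value. -/
theorem exists_adjoint_solution
    (A : C(Icc a b, EuclideanSpace ℝ (Fin n) × EuclideanSpace ℝ (Fin m) →L[ℝ]
      EuclideanSpace ℝ (Fin n)))
    (B : C(Icc a b, EuclideanSpace ℝ (Fin n) × EuclideanSpace ℝ (Fin m) →L[ℝ] ℝ))
    (k : ℝ) {τ : ℝ} (hτ : τ ∈ Icc a b) (e : EuclideanSpace ℝ (Fin n)) :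
    ∃ lam lam' : ℝ → EuclideanSpace ℝ (Fin n), Continuous lam ∧ lam τ = e ∧
      (∀ t ∈ Icc a b, HasDerivAt lam (lam' t) t) ∧
      ∀ t v, ⟪lam' t, v⟫_ℝ =
        -(k * IccExtend hab B t (v, 0) + ⟪lam t, IccExtend hab A t (v, 0)⟫_ℝ) := by
  let A' : ℝ → EuclideanSpace ℝ (Fin n) →L[ℝ] EuclideanSpace ℝ (Fin n) := fun t =>
    -ContinuousLinearMap.adjoint ((IccExtend hab A t).comp
      (ContinuousLinearMap.inl ℝ (EuclideanSpace ℝ (Fin n)) (EuclideanSpace ℝ (Fin m))))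
  let h : ℝ → EuclideanSpace ℝ (Fin n) := fun t =>
    -(k • (InnerProductSpace.toDual ℝ (EuclideanSpace ℝ (Fin n))).symm ((IccExtend hab B t).comp
      (ContinuousLinearMap.inl ℝ (EuclideanSpace ℝ (Fin n)) (EuclideanSpace ℝ (Fin m)))))
  have hA' : Continuous A' :=
    (ContinuousLinearMap.adjoint.continuous.comp
      (A.continuous.Icc_extend'.clm_comp continuous_const)).neg
  have hh : Continuous h :=
    (((InnerProductSpace.toDual ℝ (EuclideanSpace ℝ (Fin n))).symm.continuous.comp
      (B.continuous.Icc_extend'.clm_comp continuous_const)).const_smul k).neg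
  obtain ⟨lam, hlam, hτe, hd⟩ := exists_linear_ode_solution hA' hh hτ e
  refine ⟨lam, _, hlam, hτe, hd, fun t v => ?_⟩
  simp only [A', h, neg_apply, inner_add_left, inner_neg_left,
    ContinuousLinearMap.adjoint_inner_left, real_inner_smul_left,
    InnerProductSpace.toDual_symm_apply, ContinuousLinearMap.comp_apply,
    ContinuousLinearMap.inl_apply]
  ring

/-- A functional satisfying the Euler–Lagrange identity in the velocity is integration against a
solution of the adjoint equation. -/
theorem exists_adjoint_representation
    (A : C(Icc a b, EuclideanSpace ℝ (Fin n) × EuclideanSpace ℝ (Fin m) →L[ℝ]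
      EuclideanSpace ℝ (Fin n)))
    (B : C(Icc a b, EuclideanSpace ℝ (Fin n) × EuclideanSpace ℝ (Fin m) →L[ℝ] ℝ))
    (k : ℝ) (hs : s ∈ Icc a b) {τ : ℝ} (hτ : τ ∈ Icc a b) (e : EuclideanSpace ℝ (Fin n))
    (l : C(Icc a b, EuclideanSpace ℝ (Fin n)) → ℝ)
    (hl : ∀ w : C(Icc a b, EuclideanSpace ℝ (Fin n)),
      l (w - pointwiseCLM A (phasePairCLM hab s
          ((0, w, 0) : PhaseSpace S (EuclideanSpace ℝ (Fin m)) a b))) +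
        k * (∫ t in s..τ, IccExtend hab (pointwiseCLM B (phasePairCLM hab s
          ((0, w, 0) : PhaseSpace S (EuclideanSpace ℝ (Fin m)) a b))) t) +
        ⟪e, phaseState hab s 0 ((0, w, 0) : PhaseSpace S (EuclideanSpace ℝ (Fin m)) a b) τ⟫_ℝ
          = 0) :
    ∃ lam lam' : ℝ → EuclideanSpace ℝ (Fin n), Continuous lam ∧ lam τ = e ∧
      (∀ t ∈ Icc a b, HasDerivAt lam (lam' t) t) ∧
      (∀ t v, ⟪lam' t, v⟫_ℝ =
        -(k * IccExtend hab B t (v, 0) + ⟪lam t, IccExtend hab A t (v, 0)⟫_ℝ)) ∧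
      ∀ h, l h = -∫ t in s..τ, ⟪lam t, IccExtend hab h t⟫_ℝ := by
  obtain ⟨lam, lam', hlam, hτe, hd, hadj⟩ := exists_adjoint_solution hab A B k hτ e
  refine ⟨lam, lam', hlam, hτe, hd, hadj, fun h => ?_⟩
  -- The variation starting from zero at `s` whose defect is exactly `h`; inserted in `hl`, it
  -- computes `l h`.
  obtain ⟨y, w, hy, hys, hyd, hw⟩ := exists_linearized_solution (S := S) hab A h hs hs 0
  obtain ⟨hstate, hdef⟩ := hw 0 (by rw [hys]; rfl)
  have key := hl w
  rw [hdef, hstate τ hτ] at key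
  have c1 : Continuous fun t => ⟪lam t, IccExtend hab h t⟫_ℝ :=
    hlam.inner (continuous_iccExtend hab h)
  have c2 : Continuous fun t => k * IccExtend hab B t (y t, 0) :=
    continuous_const.mul (B.continuous.Icc_extend'.clm_apply (hy.prodMk continuous_const))
  have hB : ∫ t in s..τ, k * IccExtend hab B t (y t, 0) = k * ∫ t in s..τ, IccExtend hab
      (pointwiseCLM B (phasePairCLM hab s
        ((0, w, 0) : PhaseSpace S (EuclideanSpace ℝ (Fin m)) a b))) t := by
    rw [← intervalIntegral.integral_const_mul]
    refine intervalIntegral.integral_congr fun t ht => ?_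
    have ht' := ordConnected_Icc.uIcc_subset hs hτ ht
    rw [IccExtend_of_mem _ _ ht', IccExtend_of_mem _ _ ht', pointwiseCLM_apply,
      phasePairCLM_apply, hstate t ht']
    rfl
  -- In the derivative of `⟪lam t, y t⟫` the adjoint equation cancels the terms containing `A`.
  have hparts : ∫ t in s..τ, (⟪lam t, IccExtend hab h t⟫_ℝ - k * IccExtend hab B t (y t, 0)) =
      ⟪lam τ, y τ⟫_ℝ - ⟪lam s, y s⟫_ℝ := by
    refine intervalIntegral.integral_eq_sub_of_hasDerivAt (f := fun t => ⟪lam t, y t⟫_ℝ)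
      (fun t ht => ?_) ((c1.sub c2).intervalIntegrable _ _)
    have ht' := ordConnected_Icc.uIcc_subset hs hτ ht
    refine ((hd t ht').inner ℝ (hyd t ht')).congr_deriv ?_
    rw [hadj, inner_add_right]
    ring
  rw [intervalIntegral.integral_sub (c1.intervalIntegrable _ _) (c2.intervalIntegrable _ _), hB,
    hys, inner_zero_right, hτe] at hparts
  linarith

/-- For variations the base value is carried by the offset and the constant is `0`, the opposite of
the convention in `phaseCoord`. -/
theorem phaseState_of_offset {x : ℝ → EuclideanSpace ℝ (Fin n)}
    {u : ℝ → EuclideanSpace ℝ (Fin m)} (hx : ContDiff ℝ 1 x) (hu : Continuous u)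
    (hs : s ∈ Icc a b) {σ : S} (hσ : (σ : EuclideanSpace ℝ (Fin n)) = x s) {t : ℝ}
    (ht : t ∈ Icc a b) :
    phaseState hab s 0 ((σ, (phaseCoord S a b hx hu).2) :
      PhaseSpace S (EuclideanSpace ℝ (Fin m)) a b) t = x t := by
  rw [← phaseState_phaseCoord (S := S) hab hx hu hs ht]
  simp [phaseState, hσ, phaseCoord]

/-- The first variation of a phase in phase coordinates. -/
theorem integral_phaseVariation_eq {F : EuclideanSpace ℝ (Fin n) → EuclideanSpace ℝ (Fin m) → ℝ →
      EuclideanSpace ℝ (Fin n)} {L : EuclideanSpace ℝ (Fin n) → EuclideanSpace ℝ (Fin m) → ℝ → ℝ}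
    (hF : IsC1InStateControl F) (hL : IsC1InStateControl L)
    {x δx lam : ℝ → EuclideanSpace ℝ (Fin n)} {u δu : ℝ → EuclideanSpace ℝ (Fin m)}
    (hx : Continuous x) (hu : Continuous u) (hδx : ContDiff ℝ 1 δx) (hδu : Continuous δu)
    (hlam : Continuous lam) (k : ℝ) (hs : s ∈ Icc a b) {τ : ℝ} (hτ : τ ∈ Icc a b) {σ : S}
    (hσ : (σ : EuclideanSpace ℝ (Fin n)) = δx s) :
    ∫ t in s..τ, phaseVariation F L x u k lam δx δu t =
      k * (∫ t in s..τ, IccExtend hab (pointwiseCLM (hL.derivAlong hx hu a b)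
        (phasePairCLM hab s (σ, (phaseCoord S a b hδx hδu).2))) t) -
      ∫ t in s..τ, ⟪lam t, IccExtend hab ((phaseCoord S a b hδx hδu).2.1 -
        pointwiseCLM (hF.derivAlong hx hu a b) (phasePairCLM hab s
          (σ, (phaseCoord S a b hδx hδu).2)) : C(Icc a b, EuclideanSpace ℝ (Fin n))) t⟫_ℝ := by
  rw [← intervalIntegral.integral_const_mul, ← intervalIntegral.integral_sub]
  rotate_left
  · exact Continuous.intervalIntegrable (continuous_const.mul (continuous_iccExtend hab _)) _ _
  · exact (hlam.inner (continuous_iccExtend hab _)).intervalIntegrable _ _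
  refine intervalIntegral.integral_congr fun t ht => ?_
  have ht' := ordConnected_Icc.uIcc_subset hs hτ ht
  rw [IccExtend_of_mem _ _ ht', IccExtend_of_mem _ _ ht', ContinuousMap.sub_apply,
    pointwiseCLM_apply, pointwiseCLM_apply, phasePairCLM_apply,
    phaseState_of_offset hab hδx hδu hs hσ ht', phaseVariation, ← neg_sub (deriv δx t),
    inner_neg_right, ← sub_eq_add_neg]
  rfl

end Representation

/-! ### Existence of co-states -/

section Existence

open Set Filter
open scoped Topology

namespace SwitchedProblem

variable {n m : ℕ} {P : SwitchedProblem n m} {p q : SwitchedProcess n m}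
  {S : Submodule ℝ (EuclideanSpace ℝ (Fin n))}

/-- Multipliers represented by co-states. -/
theorem IsOptimal.exists_stationary (hP : P.Regular) (ho : P.IsOptimal p) {η : ℝ} (hη : 0 < η)
    (ext₁ : ∀ t ∈ Icc P.t₀ (p.τ + η), HasDerivAt p.x₁ (P.f₁ (p.x₁ t) (p.u₁ t) t) t)
    (ext₂ : ∀ t ∈ Icc (p.τ - η) P.tf, HasDerivAt p.x₂ (P.f₂ (p.x₂ t) (p.u₂ t) t) t)
    (h₁ : 0 < ⟪P.normal p, P.f₁At p⟫_ℝ) (h₂ : 0 < ⟪P.normal p, P.f₂At p⟫_ℝ) :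
    ∃ k : ℝ, (k = 0 ∨ k = 1) ∧ ∃ (lam₁ lam₂ lam₁' lam₂' : ℝ → EuclideanSpace ℝ (Fin n)) (ν : ℝ)
      (κ : EuclideanSpace ℝ (Fin n)), Continuous lam₁ ∧ Continuous lam₂ ∧
      (∀ t ∈ Icc P.t₀ P.tf, HasDerivAt lam₁ (lam₁' t) t) ∧
      (∀ t ∈ Icc P.t₀ P.tf, HasDerivAt lam₂ (lam₂' t) t) ∧
      (∀ t ∈ Icc P.t₀ P.tf, ∀ v, ⟪lam₁' t, v⟫_ℝ =
        -(k * stateControlDeriv P.L₁ (p.x₁ t, p.u₁ t) t (v, 0) +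
          ⟪lam₁ t, stateControlDeriv P.f₁ (p.x₁ t, p.u₁ t) t (v, 0)⟫_ℝ)) ∧
      (∀ t ∈ Icc P.t₀ P.tf, ∀ v, ⟪lam₂' t, v⟫_ℝ =
        -(k * stateControlDeriv P.L₂ (p.x₂ t, p.u₂ t) t (v, 0) +
          ⟪lam₂ t, stateControlDeriv P.f₂ (p.x₂ t, p.u₂ t) t (v, 0)⟫_ℝ)) ∧
      (∀ δ, P.IsVariation δ → P.firstVariation p k lam₁ lam₂ ν κ δ = 0) ∧
      (k = 0 → P.target ≠ none ∧
        ¬ ((∀ t ∈ Icc P.t₀ p.τ, lam₁ t = 0) ∧ ∀ t ∈ Icc p.τ P.tf, lam₂ t = 0)) := by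
  classical
  have hp := ho.1
  have hab := hp.le
  have ha : P.t₀ ∈ Icc P.t₀ P.tf := ⟨le_rfl, hab⟩
  have hb : P.tf ∈ Icc P.t₀ P.tf := ⟨hab, le_rfl⟩
  have hτ : p.τ ∈ Icc P.t₀ P.tf := ⟨hp.t₀_lt.le, hp.lt_tf.le⟩
  -- The offset of phase 2 is the change of the final state, so a prescribed final state means `⊥`
  -- and a free one means `⊤`.
  let S : Submodule ℝ (EuclideanSpace ℝ (Fin n)) := if P.target = none then ⊤ else ⊥
  have hSbot : P.target ≠ none → S = ⊥ := fun h => if_neg h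
  have hStop : P.target = none → S = ⊤ := fun h => if_pos h
  obtain ⟨Λ, k, hk, hne, hΛ⟩ : ∃ (Λ : Module.Dual ℝ (C(Icc P.t₀ P.tf, EuclideanSpace ℝ (Fin n)) ×
      C(Icc P.t₀ P.tf, EuclideanSpace ℝ (Fin n)) × ℝ × EuclideanSpace ℝ (Fin n))) (k : ℝ),
      (k = 0 ∨ k = 1) ∧ (Λ, k) ≠ 0 ∧ ∀ d y₁ y₂, _ + k * _ = 0 := by
    obtain ⟨Λ, k, hne, hΛ⟩ := ho.exists_multipliers hP hη ext₁ ext₂ h₁ h₂ hSbot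
    by_cases hk : k = 0
    · exact ⟨Λ, k, Or.inl hk, hne, hΛ⟩
    · refine ⟨k⁻¹ • Λ, 1, Or.inr rfl, by simp, fun d y₁ y₂ => ?_⟩
      have := congrArg (k⁻¹ * ·) (hΛ d y₁ y₂)
      simp only [mul_add, mul_zero, inv_mul_cancel_left₀ hk] at this
      rw [one_mul]
      exact this
  set A₁ := hP.f₁.derivAlong hp.x₁_C1.continuous hp.u₁_cont P.t₀ P.tf with hA₁
  set A₂ := hP.f₂.derivAlong hp.x₂_C1.continuous hp.u₂_cont P.t₀ P.tf with hA₂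
  set B₁ := hP.L₁.derivAlong hp.x₁_C1.continuous hp.u₁_cont P.t₀ P.tf with hB₁
  set B₂ := hP.L₂.derivAlong hp.x₂_C1.continuous hp.u₂_cont P.t₀ P.tf with hB₂
  let κ : EuclideanSpace ℝ (Fin n) := (InnerProductSpace.toDual ℝ _).symm
    (LinearMap.toContinuousLinearMap (Λ ∘ₗ LinearMap.inr ℝ _ _ ∘ₗ LinearMap.inr ℝ _ _ ∘ₗ
      LinearMap.inr ℝ _ _))
  let ν : ℝ := Λ (0, 0, 1, 0)
  let l₁ : C(Icc P.t₀ P.tf, EuclideanSpace ℝ (Fin n)) → ℝ := fun h => Λ (h, 0, 0, 0)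
  let l₂ : C(Icc P.t₀ P.tf, EuclideanSpace ℝ (Fin n)) → ℝ := fun h => Λ (0, h, 0, 0)
  have hκ : ∀ c, Λ (0, 0, 0, c) = ⟪κ, c⟫_ℝ := fun c => by
    simp only [κ, InnerProductSpace.toDual_symm_apply]
    rfl
  have hsplit : ∀ h₁ h₂ γ c, Λ (h₁, h₂, γ, c) = l₁ h₁ + l₂ h₂ + ν * γ + ⟪κ, c⟫_ℝ := by
    intro h₁ h₂ γ c
    have e : (h₁, h₂, γ, c) = (h₁, 0, 0, 0) + (0, h₂, 0, 0) + γ • (0, 0, 1, 0) +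
        ((0, 0, 0, c) : C(Icc P.t₀ P.tf, EuclideanSpace ℝ (Fin n)) ×
          C(Icc P.t₀ P.tf, EuclideanSpace ℝ (Fin n)) × ℝ × EuclideanSpace ℝ (Fin n)) := by
      have e₀ : γ • (0 : C(Icc P.t₀ P.tf, EuclideanSpace ℝ (Fin n))) = 0 :=
        ContinuousMap.ext fun _ => smul_zero γ
      simp [e₀]
    rw [e, map_add, map_add, map_add, map_smul, hκ, smul_eq_mul, mul_comm γ]
  have l₁0 : l₁ 0 = 0 := map_zero Λ
  have l₂0 : l₂ 0 = 0 := map_zero Λ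
  have hΛ0 : k = 0 → ν = 0 → κ = 0 → (∀ h, l₁ h = 0) → (∀ h, l₂ h = 0) → False := by
    intro hk0 hν0 hκ0 hl₁ hl₂
    refine hne (Prod.ext (LinearMap.ext fun z => ?_) hk0)
    rw [show z = (z.1, z.2.1, z.2.2.1, z.2.2.2) from rfl, hsplit, hl₁, hl₂, hν0, hκ0]
    simp
  simp only [← integralCLM_apply] at hΛ
  have hI := fun d y₁ y₂ => (hsplit _ _ _ _ ▸ hΛ d y₁ y₂)
  have z₁ : phaseState hab P.t₀ 0 (0 : PhaseSpace (⊥ : Submodule ℝ (EuclideanSpace ℝ (Fin n)))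
      (EuclideanSpace ℝ (Fin m)) P.t₀ P.tf) p.τ = 0 := by
    change 0 + 0 + integralCLM hab P.t₀ p.τ 0 = 0
    rw [map_zero, add_zero, add_zero]
  have z₂ : phaseState hab P.tf 0 (0 : PhaseSpace S (EuclideanSpace ℝ (Fin m)) P.t₀ P.tf) p.τ
      = 0 := by
    change 0 + 0 + integralCLM hab P.tf p.τ 0 = 0
    rw [map_zero, add_zero, add_zero]
  -- The identity is tested on each of the two phases and on the switching time separately.
  have hI₁ := fun y₁ => hI 0 y₁ 0
  have hI₂ := fun y₂ => hI 0 0 y₂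
  have hIτ := hI 1 0 0
  simp only [z₁, z₂, map_zero, Prod.fst_zero, Prod.snd_zero, sub_zero, l₁0, l₂0, zero_smul,
    zero_add, zero_sub, inner_neg_right, ZeroMemClass.coe_zero, zero_mul, one_smul, add_zero,
    sub_self, inner_zero_right, mul_zero, one_mul] at hI₁ hI₂ hIτ
  -- The value of the co-state at `τ` is the coefficient of the state variation at `τ` in `hI₁`.
  obtain ⟨lam₁, lam₁', hc₁, hτ₁, hd₁, hadj₁, hl₁⟩ := exists_adjoint_representation
    (S := (⊥ : Submodule ℝ (EuclideanSpace ℝ (Fin n)))) hab A₁ B₁ k ha hτ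
    (ν • P.normal p - κ) l₁ fun w => by
      rw [inner_sub_left, real_inner_smul_left, ← integralCLM_apply, ← hI₁ (0, w, 0)]
      ring
  -- Phase 2 is integrated backwards from `tf`, so the running cost enters with weight `-k`, and the
  -- co-state is `-μ`. Its value at `τ` is `-κ`.
  obtain ⟨μ, μ', hcμ, hτμ, hdμ, hadjμ, hlμ⟩ := exists_adjoint_representation
    (S := S) hab A₂ B₂ (-k) hb hτ κ l₂ fun w => by
      rw [← integralCLM_apply, ← hI₂ (0, w, 0), ZeroMemClass.coe_zero, map_zero]
      ring
  have hl₂ : ∀ h, l₂ h = ∫ t in P.tf..p.τ, ⟪-μ t, IccExtend hab h t⟫_ℝ := fun h => by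
    simp only [hlμ, inner_neg_left, intervalIntegral.integral_neg]
  refine ⟨k, hk, lam₁, fun t => -μ t, lam₁', fun t => -μ' t, ν, κ, hc₁, hcμ.neg, hd₁,
    fun t ht => (hdμ t ht).neg, fun t ht v => ?_, fun t ht v => ?_, fun δ hδ => ?_, fun hk0 => ?_⟩
  · rw [hadj₁, IccExtend_of_mem _ _ ht, IccExtend_of_mem _ _ ht]
    rfl
  · rw [inner_neg_left, inner_neg_left, hadjμ, IccExtend_of_mem _ _ ht, IccExtend_of_mem _ _ ht]
    simp only [hA₂, hB₂, IsC1InStateControl.derivAlong, ContinuousMap.coe_mk]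
    ring
  · have hσ : δ.x₂ P.tf ∈ S := by
      by_cases h : P.target = none
      · rw [hStop h]; trivial
      · rw [hSbot h, hδ.final h]; exact Submodule.zero_mem _
    have o₁ : ((0 : (⊥ : Submodule ℝ (EuclideanSpace ℝ (Fin n)))) : EuclideanSpace ℝ (Fin n)) =
      δ.x₁ P.t₀ := by rw [hδ.init]; rfl
    have o₂ : ((⟨δ.x₂ P.tf, hσ⟩ : S) : EuclideanSpace ℝ (Fin n)) = δ.x₂ P.tf := rfl
    have := hI δ.τ (0, (phaseCoord ⊥ P.t₀ P.tf hδ.x₁_C1 hδ.u₁_cont).2)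
      (⟨δ.x₂ P.tf, hσ⟩, (phaseCoord S P.t₀ P.tf hδ.x₂_C1 hδ.u₂_cont).2)
    rw [phaseState_of_offset hab hδ.x₁_C1 hδ.u₁_cont ha o₁ hτ,
      phaseState_of_offset hab hδ.x₂_C1 hδ.u₂_cont hb o₂ hτ, hl₁, hl₂] at this
    rw [firstVariation, intervalIntegral.integral_symm P.tf p.τ,
      integral_phaseVariation_eq hab hP.f₁ hP.L₁ hp.x₁_C1.continuous hp.u₁_cont hδ.x₁_C1
        hδ.u₁_cont hc₁ k ha hτ o₁,
      integral_phaseVariation_eq hab hP.f₂ hP.L₂ hp.x₂_C1.continuous hp.u₂_cont hδ.x₂_C1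
        hδ.u₂_cont (lam := fun t => -μ t) hcμ.neg k hb hτ o₂]
    simp only [integralCLM_apply] at this
    rw [← this]
    ring
  · by_cases htar : P.target = none
    · exfalso
      have hmem : ∀ y, y ∈ S := fun y => by rw [hStop htar]; trivial
      -- With the final state free, a linearized phase 2 solution can have any defect `h` and any
      -- value `c` at the switch. When `k = 0` this forces `κ = 0` and `l₂ = 0`; the equation for
      -- the switching time then gives `ν = 0`, and `l₁ = 0` follows.
      have g₂ : ∀ h c, l₂ h + ⟪κ, c⟫_ℝ = 0 := fun h c => by
        obtain ⟨y, w, -, hyr, -, hw⟩ := exists_linearized_solution (S := S) hab A₂ h hb hτ c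
        obtain ⟨hst, hdef⟩ := hw ⟨y P.tf, hmem _⟩ rfl
        have := hI₂ (⟨y P.tf, hmem _⟩, w, 0)
        rwa [hdef, hst p.τ hτ, hyr, hk0, zero_mul, add_zero] at this
      have hκ0 : κ = 0 := by
        have := g₂ 0 κ
        rwa [l₂0, zero_add, inner_self_eq_zero] at this
      have hν0 : ν = 0 := by
        rw [hκ0, hk0, inner_zero_left, zero_mul, add_zero, add_zero] at hIτ
        exact (mul_eq_zero.1 hIτ).resolve_right h₁.ne'
      refine hΛ0 hk0 hν0 hκ0 (fun h => ?_) fun h => by simpa [hκ0] using g₂ h 0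
      obtain ⟨y, w, -, hyr, -, hw⟩ := exists_linearized_solution
        (S := (⊥ : Submodule ℝ (EuclideanSpace ℝ (Fin n)))) hab A₁ h ha ha 0
      obtain ⟨-, hdef⟩ := hw 0 (by rw [hyr]; rfl)
      have := hI₁ (0, w, 0)
      rwa [hdef, hν0, hκ0, hk0, inner_zero_left, zero_mul, zero_mul, neg_zero, add_zero, add_zero,
        add_zero] at this
    · refine ⟨htar, fun ⟨v₁, v₂⟩ => ?_⟩
      -- If both co-states vanish on their phases, their values at `τ` give `κ = 0` and `ν m = 0`,
      -- and the integral representations give `l₁ = l₂ = 0`, contradicting the nontriviality of the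
      -- multiplier.
      have hκ0 : κ = 0 := by
        rw [← hτμ]
        exact neg_eq_zero.1 (v₂ p.τ ⟨le_rfl, hp.lt_tf.le⟩)
      have hν0 : ν = 0 := by
        have := v₁ p.τ ⟨hp.t₀_lt.le, le_rfl⟩
        rw [hτ₁, hκ0, sub_zero] at this
        refine (smul_eq_zero.1 this).resolve_right fun h0 => ?_
        rw [h0, inner_zero_left] at h₁
        exact lt_irrefl _ h₁
      refine hΛ0 hk0 hν0 hκ0 (fun h => ?_) fun h => ?_
      · rw [hl₁, neg_eq_zero]
        refine intervalIntegral.integral_zero_ae (Eventually.of_forall fun t ht => ?_)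
        rw [uIoc_of_le hp.t₀_lt.le] at ht
        rw [v₁ t ⟨ht.1.le, ht.2⟩, inner_zero_left]
      · rw [hl₂]
        refine intervalIntegral.integral_zero_ae (Eventually.of_forall fun t ht => ?_)
        rw [uIoc_of_ge hp.lt_tf.le] at ht
        rw [show -μ t = 0 from v₂ t ⟨ht.1.le, ht.2⟩, inner_zero_left]

/-- The augmented cost of a varied process sees the states beyond their phases when the switching
time moves, but its first variation does not. Hence multipliers of a process with extended states
are also multipliers of the original one. -/
theorem firstVariation_congr (hp : P.Admissible p) (hτ : q.τ = p.τ) (hu₁ : q.u₁ = p.u₁)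
    (hu₂ : q.u₂ = p.u₂) (hx₁ : ∀ t ∈ Icc P.t₀ p.τ, q.x₁ t = p.x₁ t)
    (hx₂ : ∀ t ∈ Icc p.τ P.tf, q.x₂ t = p.x₂ t) (a : ℝ)
    (lam₁ lam₂ : ℝ → EuclideanSpace ℝ (Fin n)) (ν : ℝ) (κ : EuclideanSpace ℝ (Fin n))
    (δ : SwitchedProcess n m) :
    P.firstVariation q a lam₁ lam₂ ν κ δ = P.firstVariation p a lam₁ lam₂ ν κ δ := by
  have e₁ := hx₁ p.τ ⟨hp.t₀_lt.le, le_rfl⟩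
  have e₂ := hx₂ p.τ ⟨le_rfl, hp.lt_tf.le⟩
  have e₃ := hx₂ P.tf ⟨hp.lt_tf.le, le_rfl⟩
  have i₁ : ∫ t in P.t₀..p.τ, phaseVariation P.f₁ P.L₁ q.x₁ p.u₁ a lam₁ δ.x₁ δ.u₁ t =
      ∫ t in P.t₀..p.τ, phaseVariation P.f₁ P.L₁ p.x₁ p.u₁ a lam₁ δ.x₁ δ.u₁ t :=
    intervalIntegral.integral_congr fun t ht => by
      rw [uIcc_of_le hp.t₀_lt.le] at ht
      simp only [phaseVariation, hx₁ t ht]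
  have i₂ : ∫ t in p.τ..P.tf, phaseVariation P.f₂ P.L₂ q.x₂ p.u₂ a lam₂ δ.x₂ δ.u₂ t =
      ∫ t in p.τ..P.tf, phaseVariation P.f₂ P.L₂ p.x₂ p.u₂ a lam₂ δ.x₂ δ.u₂ t :=
    intervalIntegral.integral_congr fun t ht => by
      rw [uIcc_of_le hp.lt_tf.le] at ht
      simp only [phaseVariation, hx₂ t ht]
  simp only [firstVariation, normal, f₁At, f₂At, jumpL, hτ, hu₁, hu₂, e₁, e₂, e₃, i₁, i₂]

/-- Left difference quotients of `g ∘ x₁` at `τ` are nonnegative, since `g` is negative before the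
switch and zero at it. -/
theorem Admissible.inner_normal_f₁At_nonneg (hP : P.Regular) (hp : P.Admissible p) :
    0 ≤ ⟪P.normal p, P.f₁At p⟫_ℝ := by
  have h := ((hP.g.differentiable one_ne_zero (p.x₁ p.τ)).hasFDerivAt.comp_hasDerivAt p.τ
    (hp.dyn₁ p.τ ⟨hp.t₀_lt.le, le_rfl⟩)).hasDerivWithinAt (s := Iio p.τ)
  rw [inner_normal]
  refine ge_of_tendsto ((hasDerivWithinAt_iff_tendsto_slope' (by simp)).1 h) ?_
  filter_upwards [Ioo_mem_nhdsLT hp.t₀_lt] with t ht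
  rw [slope_def_field, Function.comp_apply, Function.comp_apply, hp.crossing, sub_zero]
  exact div_nonneg_of_nonpos (hp.before t ⟨ht.1.le, ht.2⟩).le (by linarith [ht.2])

theorem Admissible.inner_normal_f₂At_nonneg (hP : P.Regular) (hp : P.Admissible p) :
    0 ≤ ⟪P.normal p, P.f₂At p⟫_ℝ := by
  have h := ((hP.g.differentiable one_ne_zero (p.x₂ p.τ)).hasFDerivAt.comp_hasDerivAt p.τ
    (hp.dyn₂ p.τ ⟨le_rfl, hp.lt_tf.le⟩)).hasDerivWithinAt (s := Ioi p.τ)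
  rw [inner_normal, hp.junction]
  refine ge_of_tendsto ((hasDerivWithinAt_iff_tendsto_slope' (by simp)).1 h) ?_
  filter_upwards [Ioo_mem_nhdsGT hp.lt_tf] with t ht
  rw [slope_def_field, Function.comp_apply, Function.comp_apply, ← hp.junction, hp.crossing,
    sub_zero]
  exact div_nonneg (hp.after t ⟨ht.1, ht.2.le⟩).le (by linarith [ht.1])

/-- Changing the states outside their phases preserves optimality. -/
theorem IsOptimal.congr (ho : P.IsOptimal p) {y₁ y₂ : ℝ → EuclideanSpace ℝ (Fin n)}
    (c₁ : ContDiff ℝ 1 y₁) (c₂ : ContDiff ℝ 1 y₂) (e₁ : ∀ t ≤ p.τ, y₁ t = p.x₁ t)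
    (e₂ : ∀ t, p.τ ≤ t → y₂ t = p.x₂ t)
    (d₁ : ∀ t ∈ Icc P.t₀ p.τ, HasDerivAt y₁ (P.f₁ (y₁ t) (p.u₁ t) t) t)
    (d₂ : ∀ t ∈ Icc p.τ P.tf, HasDerivAt y₂ (P.f₂ (y₂ t) (p.u₂ t) t) t) :
    P.IsOptimal { p with x₁ := y₁, x₂ := y₂ } := by
  have hp := ho.1
  have h0 := hp.t₀_lt.le
  have hf := hp.lt_tf.le
  refine ⟨⟨hp.t₀_lt, hp.lt_tf, hp.u₁_cont, hp.u₂_cont, c₁, c₂, d₁, d₂, ?_, ?_, ?_, ?_, ?_, ?_⟩, ?_⟩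
  · exact (e₁ _ h0).trans hp.init
  · exact fun xf hxf => (e₂ _ hf).trans (hp.final xf hxf)
  · exact (e₁ _ le_rfl).trans (hp.junction.trans (e₂ _ le_rfl).symm)
  · intro t ht
    exact (congrArg P.g (e₁ t ht.2.le)).trans_lt (hp.before t ht)
  · exact (congrArg P.g (e₁ _ le_rfl)).trans hp.crossing
  · intro t ht
    exact (hp.after t ht).trans_eq (congrArg P.g (e₂ t ht.1.le)).symm
  · intro q hq
    refine le_trans (le_of_eq ?_) (ho.2 q hq)
    rw [cost, cost]
    congr 1
    · congr 1
      · exact congrArg P.φ (e₂ _ hf)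
      · refine intervalIntegral.integral_congr fun t ht => ?_
        rw [uIcc_of_le h0] at ht
        simp only [e₁ t ht.2]
    · refine intervalIntegral.integral_congr fun t ht => ?_
      rw [uIcc_of_le hf] at ht
      simp only [e₂ t ht.1]

/-- Perturbing the switching time in either direction requires the dynamics to hold slightly beyond
each phase. The states are therefore continued by solving the differential equations with the same
controls, multipliers are found for the continued process, and they are carried back through the
first variation. -/
theorem IsOptimal.exists_isCostate (hP : P.Regular) (ho : P.IsOptimal p)
    (h₁ : 0 < ⟪P.normal p, P.f₁At p⟫_ℝ) (h₂ : 0 < ⟪P.normal p, P.f₂At p⟫_ℝ)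
    (hn : P.target = none ∨ P.IsNormal p) :
    ∃ lam₁ lam₂ : ℝ → EuclideanSpace ℝ (Fin n), P.IsCostate p lam₁ lam₂ := by
  have hp := ho.1
  obtain ⟨η₁, hη₁, y₁, c₁, e₁, d₁⟩ := exists_ode_extension_right
    (F := fun t x => P.f₁ x (p.u₁ t) t)
    (F' := fun t x => (stateControlDeriv P.f₁ (x, p.u₁ t) t).comp (ContinuousLinearMap.inl ℝ _ _))
    (hP.f₁.continuous_comp continuous_snd (hp.u₁_cont.comp continuous_fst) continuous_fst)
    ((hP.f₁.continuous_deriv_comp continuous_snd (hp.u₁_cont.comp continuous_fst)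
      continuous_fst).clm_comp continuous_const)
    (fun t x => hP.f₁.hasFDerivAt_state x _ t) hp.t₀_lt.le hp.x₁_C1 hp.dyn₁
  obtain ⟨η₂, hη₂, y₂, c₂, e₂, d₂⟩ := exists_ode_extension_left
    (F := fun t x => P.f₂ x (p.u₂ t) t)
    (F' := fun t x => (stateControlDeriv P.f₂ (x, p.u₂ t) t).comp (ContinuousLinearMap.inl ℝ _ _))
    (hP.f₂.continuous_comp continuous_snd (hp.u₂_cont.comp continuous_fst) continuous_fst)
    ((hP.f₂.continuous_deriv_comp continuous_snd (hp.u₂_cont.comp continuous_fst)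
      continuous_fst).clm_comp continuous_const)
    (fun t x => hP.f₂.hasFDerivAt_state x _ t) hp.lt_tf.le hp.x₂_C1 hp.dyn₂
  have ho' := ho.congr c₁ c₂ e₁ e₂ (fun t ht => d₁ t ⟨ht.1, by linarith [ht.2]⟩)
    (fun t ht => d₂ t ⟨by linarith [ht.1], ht.2⟩)
  obtain ⟨k, hk, lam₁, lam₂, lam₁', lam₂', ν, κ, k₁, k₂, hd₁, hd₂, a₁, a₂, hst, hne⟩ :=
    ho'.exists_stationary hP (η := min η₁ η₂) (lt_min hη₁ hη₂)
      (fun t ht => d₁ t ⟨ht.1, ht.2.trans (add_le_add_right (min_le_left _ _) _)⟩)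
      (fun t ht => d₂ t ⟨(sub_le_sub_left (min_le_right _ _) _).trans ht.1, ht.2⟩)
      (by simpa only [normal, f₁At, e₁ p.τ le_rfl] using h₁)
      (by simpa only [normal, f₂At, e₁ p.τ le_rfl, e₂ p.τ le_rfl] using h₂)
  have hst' : P.IsStationary p k lam₁ lam₂ ν κ := by
    rw [hp.isStationary_iff hP k₁ k₂]
    intro δ hδ
    rw [← hst δ hδ]
    exact (firstVariation_congr (q := { p with x₁ := y₁, x₂ := y₂ }) hp rfl rfl rfl
      (fun t ht => e₁ t ht.2) (fun t ht => e₂ t ht.1) _ _ _ _ _ _).symm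
  rcases hk with rfl | rfl
  -- Weight zero occurs only with a prescribed final state, where normality would make the co-states
  -- vanish.
  · obtain ⟨htar, hnz⟩ := hne rfl
    exact absurd (hn.resolve_left htar lam₁ lam₂ ν κ k₁ k₂ hst') hnz
  · refine ⟨lam₁, lam₂, k₁, k₂, fun t ht => ?_, fun t ht => ?_, ν, κ, hst'⟩
    · have htI : t ∈ Icc P.t₀ P.tf := ⟨ht.1.le, ht.2.le.trans hp.lt_tf.le⟩
      refine (hd₁ t htI).congr_deriv (ext_inner_right ℝ fun v => ?_)
      rw [a₁ t htI v, inner_neg_left, one_mul]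
      dsimp only
      rw [e₁ t ht.2.le]
      exact congrArg Neg.neg (inner_gradient_hamiltonian hP.f₁ hP.L₁ _ _ v _ t).symm
    · have htI : t ∈ Icc P.t₀ P.tf := ⟨hp.t₀_lt.le.trans ht.1.le, ht.2.le⟩
      refine (hd₂ t htI).congr_deriv (ext_inner_right ℝ fun v => ?_)
      rw [a₂ t htI v, inner_neg_left, one_mul]
      dsimp only
      rw [e₂ t ht.1.le]
      exact congrArg Neg.neg (inner_gradient_hamiltonian hP.f₂ hP.L₂ _ _ v _ t).symm

end SwitchedProblem

end Existence

/-! ### Jump law and existence of a co-state. -/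

theorem mainTheorem2 {n m : ℕ} (P : SwitchedProblem n m) (hP : P.Regular)
    (p : SwitchedProcess n m) (hp : P.IsOptimal p) :
    (∀ lam₁ lam₂ : ℝ → EuclideanSpace ℝ (Fin n), P.IsCostate p lam₁ lam₂ →
      ⟪P.normal p, P.avgf p⟫_ℝ ≠ 0 →
      lam₂ p.τ - lam₁ p.τ =
        (-(P.jumpL p + ⟪(1 / 2 : ℝ) • (lam₂ p.τ + lam₁ p.τ), P.jumpf p⟫_ℝ) /
          ⟪P.normal p, P.avgf p⟫_ℝ) • P.normal p) ∧
    (⟪P.normal p, P.f₁At p⟫_ℝ ≠ 0 → ⟪P.normal p, P.f₂At p⟫_ℝ ≠ 0 →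
      (P.target = none ∨ P.IsNormal p) →
      ⟪P.normal p, P.avgf p⟫_ℝ ≠ 0 ∧
        ∃ lam₁ lam₂ : ℝ → EuclideanSpace ℝ (Fin n), P.IsCostate p lam₁ lam₂) := by
  refine ⟨fun lam₁ lam₂ hc hne => hc.jump_eq hP hp.1 hne, fun hne₁ hne₂ hn => ?_⟩
  -- Admissibility already fixes the signs, so nonvanishing means positivity, and the average cannot
  -- cancel.
  have h₁ := lt_of_le_of_ne (hp.1.inner_normal_f₁At_nonneg hP) hne₁.symm
  have h₂ := lt_of_le_of_ne (hp.1.inner_normal_f₂At_nonneg hP) hne₂.symm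
  refine ⟨?_, hp.exists_isCostate hP h₁ h₂ hn⟩
  rw [SwitchedProblem.avgf, real_inner_smul_right, inner_add_right]
  positivity
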